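/- Agents of two types, $H$ (hard-to-match) and $E$ (easy-to-match), arrive to a market according to independent Poisson processes of rates $\lambda_H,\lambda_E>0$. An agent of type $H$ (resp. $E$) finds the item of any other agent compatible with probability $p_H\in(0,1)$ (resp. $p_E\in(0,1]$), independently over ordered pairs of agents. Under the policy BilateralMatch($H$), if a newly arrived agent forms a 2-cycle of mutual compatibility with at least one waiting agent, she is at once matched with one of these (type $H$ having priority over type $E$, further ties being broken uniformly at random) and both leave; otherwise she joins the market and waits. The numbers of waiting $H$ and $E$ agents form a continuous-time Markov chain on $\mathbb{N}^2$. Let $w_H=w_H(\lambda_H,\lambda_E,p_H,p_E)$ be the average waiting time in steady state of an $H$ agent (the expected difference between her departure and arrival times when the market she arrives to is in its steady-state distribution). Then the equation $(x+1)\ln\bigl(2-\tfrac{2}{x+1}\bigr)=1$ has a unique solution $x^*$, with $x^*\approx 2.18$ (rounded to two decimals), and the following holds for all fixed $\lambda_E>0$ and $p_E\in(0,1]$. For every $\lambda_H>\lambda_E$, the chain has a unique steady-state distribution for every $p_H\in(0,1)$, and the limiting average waiting time $$W(\lambda_H)=\lim_{p_H\to 0^+}p_H^2\,w_H(\lambda_H,\lambda_E,p_H,p_E)$$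 exists and is finite; and $W$ is strictly increasing on the interval $\lambda_E<\lambda_H<x^*\lambda_E$ and strictly decreasing on the interval $\lambda_H>x^*\lambda_E$. -/

import Mathlib

open Set Filter Topology
open scoped ENNReal NNReal Nat

/-- The two types of agents: hard-to-match (`H`) and easy-to-match (`E`). -/
inductive AgentType where
  | H
  | E

/-- Parameters of the market: agents of type `T` arrive according to independent Poisson processes
of rates `lamH`, `lamE`; an agent of type `H` (resp. `E`) finds the item of any other agent
compatible with probability `pH` (resp. `pE`), independently. -/
structure Market where
  lamH : ℝ
  lamE : ℝ
  pH : ℝ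
  pE : ℝ

/-- State of the market: `(h, e)`, the numbers of waiting `H` agents and `E` agents. -/
abbrev MarketState : Type := ℕ × ℕ

/-- The state after a `T` agent has been added. -/
def MarketState.add (s : MarketState) : AgentType → MarketState
  | .H => (s.1 + 1, s.2)
  | .E => (s.1, s.2 + 1)

namespace Market

/-- Arrival rate of `T` agents. -/
def lam (M : Market) : AgentType → ℝ
  | .H => M.lamH
  | .E => M.lamE

/-- Probability that a `T` agent finds a given item compatible. -/
def p (M : Market) : AgentType → ℝ
  | .H => M.pH
  | .E => M.pE

/-- Total arrival rate. -/
def totalRate (M : Market) : ℝ := M.lamH + M.lamE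

/-! Under BilateralMatch(H), a newly arrived agent is matched through a 2-cycle if there is one,
2-cycles with `H` agents having priority over those with `E` agents, and otherwise joins the market.
An arriving `T` agent forms a 2-cycle with each waiting `T'` agent independently with probability
`p T * p T'`. No 2-cycles are present among the agents already waiting. -/

/-- Probability that a `T` agent arriving in state `s` is matched with a waiting `H` agent:
it forms a 2-cycle with at least one of them. -/
noncomputable def matchH (M : Market) (T : AgentType) (s : MarketState) : ℝ :=
  1 - (1 - M.p T * M.pH) ^ s.1

/-- Probability that a `T` agent arriving in state `s` is matched with a waiting `E` agent:
it forms no 2-cycle with an `H` agent, but at least one with an `E` agent. -/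
noncomputable def matchE (M : Market) (T : AgentType) (s : MarketState) : ℝ :=
  (1 - M.p T * M.pH) ^ s.1 * (1 - (1 - M.p T * M.pE) ^ s.2)

/-- Probability that a `T` agent arriving in state `s` forms no 2-cycle, and so joins the market. -/
noncomputable def join (M : Market) (T : AgentType) (s : MarketState) : ℝ :=
  (1 - M.p T * M.pH) ^ s.1 * (1 - M.p T * M.pE) ^ s.2

/-- Rate at which arrivals of `T` agents move the market from `s` to `s'`. -/
noncomputable def arrivalRate (M : Market) (T : AgentType) (s s' : MarketState) : ℝ :=
  M.lam T *
    ((if s' = s.add T then M.join T s else 0) +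
     (if s'.add .H = s then M.matchH T s else 0) +
     (if s'.add .E = s then M.matchE T s else 0))

/-- Transition rates (off the diagonal) of the continuous-time Markov chain of the numbers of
waiting agents under BilateralMatch(H). Every arrival changes the state, so the diagonal is `0`. -/
noncomputable def rate (M : Market) (s s' : MarketState) : ℝ :=
  M.arrivalRate .H s s' + M.arrivalRate .E s s'

/-- `π` is a steady-state (stationary) distribution of the chain: in every state the probability
flow in equals the probability flow out. The rates are bounded, so the chain does not explode. -/
def IsSteadyState (M : Market) (π : PMF MarketState) : Prop :=
  ∀ s, ∑' s', π s' * ENNReal.ofReal (M.rate s' s) = π s * ∑' s', ENNReal.ofReal (M.rate s s')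

/-- Consider a tagged `H` agent who waits in the market, in state `s = (h, e)` (she is counted in
`h`, so `1 ≤ h`). `M.unmatched n s` is the probability that she is still unmatched after the next
`n` arrivals. Each arrival is of type `T` with probability `lam T / totalRate`; if the arriving
agent is matched with one of the `h` waiting `H` agents, ties being broken uniformly at random,
that one is the tagged agent with probability `1 / h`. -/
noncomputable def unmatched (M : Market) : ℕ → MarketState → ℝ
  | 0, _ => 1
  | n + 1, s =>
    let afterArrival (T : AgentType) : ℝ :=
      M.join T s * M.unmatched n (s.add T) +
      M.matchE T s * M.unmatched n (s.1, s.2 - 1) +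
      M.matchH T s * (1 - 1 / (s.1 : ℝ)) * M.unmatched n (s.1 - 1, s.2)
    M.lamH / M.totalRate * afterArrival .H + M.lamE / M.totalRate * afterArrival .E

/-- Probability that an `H` agent who arrives when the market is distributed according to `π` waits
(departure time minus arrival time) longer than `t`: she is not matched upon arrival, and she is
not matched by any of the arrivals, Poisson with mean `totalRate * t` in number, within time `t`
after her own arrival. -/
noncomputable def waitTailH (M : Market) (π : PMF MarketState) (t : ℝ) : ℝ≥0∞ :=
  ∑' s, π s * ENNReal.ofReal (M.join .H s) *
    ∑' n : ℕ, ENNReal.ofReal (Real.exp (-(M.totalRate * t)) * (M.totalRate * t) ^ n / (n ! : ℝ)) *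
      ENNReal.ofReal (M.unmatched n (s.add .H))

/-- Average waiting time of an `H` agent who arrives when the market is distributed according
to `π`, i.e. the expectation of the waiting time, as the integral of its tail. -/
noncomputable def meanWaitH (M : Market) (π : PMF MarketState) : ℝ≥0∞ :=
  ∫⁻ t in Ioi (0 : ℝ), M.waitTailH π t

end Market

/-! Every arrival changes the state, so the chain has the constant exit rate `totalRate` and may be
replaced by its jump chain. A quadratic Lyapunov function gives a stationary law with finite mean
queue (`exists_steadyState`). It is unique because the empty market is reachable from every state
(`steadyState_unique`).

Little's law (`meanWaitH_eq`) turns the average wait into the mean number of waiting `H` agents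
divided by `lamH`. Write h for that number, α for the fraction of arrivals of type `H`, and θ =
-ln(1 - pH²), so that an arriving `H` agent misses all h waiting ones with probability exp(-θh).
Where E agents interfere little, h has mean drift 2α exp(-θh) - 1 per arrival: an `E` arrival almost
surely removes an `H` agent once h is of order 1/pH². The drift vanishes at θh = ln(2α), which is
positive as lamH > lamE.

The concentration of θh there is a second drift argument (`drift_level`). With z = θh - ln(2α), it
bounds the stationary mean of z(1 - exp(-z)) by θ/2 + θ/(pE pH), which is O(pH) since θ ~ pH². Hence
the mean of |z| tends to 0, and pH² w_H tends to ln(2 lamH/(lamH + lamE))/lamH, which is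
`limitWait`. No description of the stationary law of the `E` agents is needed.

The derivative of this limit in lamH has the sign of 1 - `crit` (lamH/lamE), and `crit` increases
strictly on [1, ∞) through the value 1 at x*. -/

/-! ### Stationary measures of Markov chains on a countable set. -/

namespace CountableChain

variable {S : Type*} {K : S → S → ℝ≥0∞} {π : S → ℝ≥0∞}

/-- The measure `π` after one step of the chain with transition kernel `K`. -/
noncomputable def push (K : S → S → ℝ≥0∞) (π : S → ℝ≥0∞) (s : S) : ℝ≥0∞ := ∑' s', π s' * K s' s

theorem tsum_push_mul (K : S → S → ℝ≥0∞) (π f : S → ℝ≥0∞) :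
    ∑' s, push K π s * f s = ∑' s, π s * ∑' s', K s s' * f s' := by
  simp only [push, ← ENNReal.tsum_mul_right, ← ENNReal.tsum_mul_left]
  rw [ENNReal.tsum_comm]
  simp only [mul_assoc]

theorem tsum_push (hK : ∀ s, ∑' s', K s s' = 1) (π : S → ℝ≥0∞) :
    ∑' s, push K π s = ∑' s, π s := by
  simpa [hK] using tsum_push_mul K π fun _ => 1

theorem push_mono {π π' : S → ℝ≥0∞} (h : ∀ s, π s ≤ π' s) (s : S) :
    push K π s ≤ push K π' s :=
  ENNReal.tsum_le_tsum fun s' => mul_le_mul_left (h s') _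

theorem push_add (K : S → S → ℝ≥0∞) (π π' : S → ℝ≥0∞) (s : S) :
    push K (fun s => π s + π' s) s = push K π s + push K π' s := by
  simp only [push, add_mul, ENNReal.tsum_add]

/-- A kernel preserves total mass, so by this a finite measure that dominates its own push-forward,
or is compared with another of no larger mass, is equal to it. -/
theorem eq_of_le_of_tsum_le {p q : S → ℝ≥0∞} (hle : ∀ s, p s ≤ q s)
    (hsum : ∑' s, q s ≤ ∑' s, p s) (hfin : ∑' s, p s ≠ ∞) (s : S) : p s = q s := by
  have h1 : ∑' s, q s = ∑' s, p s + ∑' s, (q s - p s) := by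
    rw [← ENNReal.tsum_add]
    exact tsum_congr fun s => (add_tsub_cancel_of_le (hle s)).symm
  have h2 : ∑' s, (q s - p s) = 0 := by
    rw [h1] at hsum
    have : ∑' s, p s + ∑' s, (q s - p s) ≤ ∑' s, p s + 0 := by simpa using hsum
    simpa using (ENNReal.add_le_add_iff_left hfin).1 this
  have h3 := ENNReal.tsum_eq_zero.1 h2 s
  exact le_antisymm (hle s) (tsub_eq_zero_iff_le.1 h3)

theorem ne_zero_of_step (hπ : ∀ s, push K π s = π s) {s s' : S} (hs : π s ≠ 0)
    (hK : K s s' ≠ 0) : π s' ≠ 0 := by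
  rw [← hπ s']
  refine fun h => mul_ne_zero hs hK ?_
  exact ENNReal.tsum_eq_zero.1 h s

/-- Drift bound: no integrability of `V` under the stationary measure is needed. -/
theorem tsum_mul_le_of_drift (hK : ∀ s, ∑' s', K s s' = 1) (hπ : ∀ s, push K π s = π s)
    (hπ1 : ∑' s, π s = 1) {V g : S → ℝ≥0∞} {b : ℝ≥0∞} (hV : ∀ s, V s ≠ ∞)
    (hdrift : ∀ s, ∑' s', K s s' * V s' + g s ≤ V s + b) :
    ∑' s, π s * g s ≤ b := by
  classical
  -- Truncating `V` at k makes its mean finite, so it cancels by stationarity. The drift inequality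
  -- survives where `V` ≤ k; elsewhere the truncation is already at its maximum k and cannot rise,
  -- so `g` is dropped there.
  have key : ∀ k : ℕ, ∑' s, π s * (if V s ≤ k then g s else 0) ≤ b := by
    intro k
    have hpt : ∀ s, ∑' s', K s s' * min (V s') k + (if V s ≤ k then g s else 0)
        ≤ min (V s) k + b := by
      intro s
      split_ifs with h
      · rw [min_eq_left h]
        refine le_trans (add_le_add_left (ENNReal.tsum_le_tsum fun s' => ?_) _) (hdrift s)
        exact mul_le_mul_right (min_le_left _ _) _
      · rw [min_eq_right (not_le.1 h).le, add_zero]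
        refine le_trans (ENNReal.tsum_le_tsum fun s' => mul_le_mul_right (min_le_right _ _) _) ?_
        rw [ENNReal.tsum_mul_right, hK, one_mul]
        exact le_self_add
    have hfin : ∑' s, π s * min (V s) k ≠ ∞ := by
      refine ne_top_of_le_ne_top (ENNReal.natCast_ne_top k) ?_
      refine le_trans (ENNReal.tsum_le_tsum fun s => mul_le_mul_right (min_le_right _ _) _) ?_
      rw [ENNReal.tsum_mul_right, hπ1, one_mul]
    have h1 : ∑' s, π s * min (V s) k = ∑' s, π s * ∑' s', K s s' * min (V s') k := by
      rw [← tsum_push_mul K π fun s => min (V s) k]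
      simp only [hπ]
    have h2 := ENNReal.tsum_le_tsum fun s => mul_le_mul_right (hpt s) (π s)
    simp only [mul_add, ENNReal.tsum_add] at h2
    rw [← h1, ENNReal.tsum_mul_right, hπ1, one_mul] at h2
    exact (ENNReal.add_le_add_iff_left hfin).1 h2
  rw [ENNReal.tsum_eq_iSup_sum]
  refine iSup_le fun F => ?_
  obtain ⟨k, hk⟩ : ∃ k : ℕ, ∑ s ∈ F, V s ≤ k := by
    obtain ⟨k, hk⟩ := ENNReal.exists_nat_gt (ENNReal.sum_ne_top.2 fun s (_ : s ∈ F) => hV s)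
    exact ⟨k, hk.le⟩
  refine le_trans ?_ (key k)
  refine le_trans (Finset.sum_le_sum fun s hs => ?_) (ENNReal.sum_le_tsum F)
  rw [if_pos ((Finset.single_le_sum (f := V) (fun _ _ => zero_le) hs).trans hk)]

/-- A stationary probability measure exists if `V` has a drift with finite sublevel sets of `g`. -/
theorem exists_stationary [Nonempty S] (hK : ∀ s, ∑' s', K s s' = 1) {V g : S → ℝ≥0∞} {b : ℝ≥0∞}
    (hV : ∀ s, V s ≠ ∞) (hb : b ≠ ∞) (hg : ∀ c : ℕ, {s | g s ≤ c}.Finite)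
    (hdrift : ∀ s, ∑' s', K s s' * V s' + g s ≤ V s + b) :
    ∃ π : S → ℝ≥0∞, ∑' s, π s = 1 ∧ ∀ s, push K π s = π s := by
  classical
  obtain ⟨s₀⟩ := ‹Nonempty S›
  set μ : ℕ → S → ℝ≥0∞ := fun n => (push K)^[n] (Pi.single s₀ 1) with hμ
  have hμs : ∀ n, μ (n + 1) = push K (μ n) := fun n => by
    simp only [hμ, Function.iterate_succ_apply']
  have hμ0 : ∀ f : S → ℝ≥0∞, ∑' s, μ 0 s * f s = f s₀ := by
    intro f
    rw [tsum_eq_single s₀]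
    · simp [hμ]
    · intro s hs
      simp [hμ, hs]
  have hμ1 : ∀ n, ∑' s, μ n s = 1 := by
    intro n
    induction n with
    | zero => simpa using hμ0 fun _ => 1
    | succ n ih => rw [hμs, tsum_push hK, ih]
  -- Summing the drift inequality along the chain started at `s₀` bounds the time average of the
  -- mean of `g`.
  have hsum : ∀ N : ℕ, ∑' s, μ N s * V s + ∑ n ∈ Finset.range N, ∑' s, μ n s * g s
      ≤ V s₀ + N * b := by
    intro N
    induction N with
    | zero => simp [hμ0]
    | succ N ih =>
      have h2 := ENNReal.tsum_le_tsum fun s => mul_le_mul_right (hdrift s) (μ N s)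
      simp only [mul_add, ENNReal.tsum_add] at h2
      rw [← tsum_push_mul, ENNReal.tsum_mul_right, hμ1, one_mul, ← hμs] at h2
      rw [Finset.sum_range_succ]
      calc _ = (∑' s, μ (N + 1) s * V s + ∑' s, μ N s * g s) +
            ∑ n ∈ Finset.range N, ∑' s, μ n s * g s := by ring
        _ ≤ (∑' s, μ N s * V s + b) + ∑ n ∈ Finset.range N, ∑' s, μ n s * g s := by gcongr
        _ = (∑' s, μ N s * V s + ∑ n ∈ Finset.range N, ∑' s, μ n s * g s) + b := by ring
        _ ≤ (V s₀ + N * b) + b := by gcongr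
        _ = _ := by push_cast; ring
  -- Cesàro averages: a push-forward changes them only by a boundary term of size 1/(N + 1).
  set ν : ℕ → S → ℝ≥0∞ := fun N s => ((N : ℝ≥0∞) + 1)⁻¹ * ∑ n ∈ Finset.range (N + 1), μ n s
    with hν
  have hc0 : ∀ N : ℕ, ((N : ℝ≥0∞) + 1) ≠ 0 := fun N => by simp
  have hct : ∀ N : ℕ, ((N : ℝ≥0∞) + 1) ≠ ∞ := fun N => by simp
  have hνf : ∀ N (f : S → ℝ≥0∞), ∑' s, ν N s * f s =
      ((N : ℝ≥0∞) + 1)⁻¹ * ∑ n ∈ Finset.range (N + 1), ∑' s, μ n s * f s := by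
    intro N f
    rw [← Summable.tsum_finsetSum (fun _ _ => ENNReal.summable), ← ENNReal.tsum_mul_left]
    refine tsum_congr fun s => ?_
    rw [hν, ← Finset.sum_mul, mul_assoc]
  have hν1 : ∀ N, ∑' s, ν N s = 1 := by
    intro N
    have := hνf N fun _ => 1
    simp only [mul_one, hμ1, Finset.sum_const, Finset.card_range, nsmul_eq_mul] at this
    rw [this]
    push_cast
    exact ENNReal.inv_mul_cancel (hc0 N) (hct N)
  have hνg : ∀ N, ∑' s, ν N s * g s ≤ V s₀ + b := by
    intro N
    rw [hνf, mul_comm, ← div_eq_mul_inv]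
    refine ENNReal.div_le_of_le_mul ?_
    refine le_trans (le_trans le_add_self (hsum (N + 1))) ?_
    push_cast
    rw [add_mul (V s₀), mul_comm b]
    gcongr
    exact le_mul_of_one_le_right zero_le le_add_self
  have hνpush : ∀ N s, push K (ν N) s ≤ ν N s + ((N : ℝ≥0∞) + 1)⁻¹ := by
    intro N s
    have h1 : push K (ν N) s = ((N : ℝ≥0∞) + 1)⁻¹ * ∑ n ∈ Finset.range (N + 1), μ (n + 1) s := by
      rw [push, hνf]
      simp only [hμs, push]
    rw [h1, hν]
    have h2 : ∑ n ∈ Finset.range (N + 1), μ (n + 1) s ≤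
        ∑ n ∈ Finset.range (N + 1), μ n s + 1 := by
      calc _ ≤ ∑ n ∈ Finset.range (N + 1), μ (n + 1) s + μ 0 s := le_self_add
        _ = ∑ n ∈ Finset.range (N + 1), μ n s + μ (N + 1) s := by
          rw [← Finset.sum_range_succ' (fun n => μ n s), Finset.sum_range_succ]
        _ ≤ _ := by
          gcongr
          exact (hμ1 (N + 1)) ▸ ENNReal.le_tsum s
    calc _ ≤ ((N : ℝ≥0∞) + 1)⁻¹ * (∑ n ∈ Finset.range (N + 1), μ n s + 1) := by gcongr
      _ = _ := by rw [mul_add, mul_one]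
  -- Since [0, ∞] is compact, an ultrafilter yields all pointwise limits at once, without extracting
  -- subsequences.
  set U : Ultrafilter ℕ := hyperfilter ℕ
  have hlim : ∀ s, ∃ x, Tendsto (fun N => ν N s) U (𝓝 x) := by
    intro s
    obtain ⟨x, -, hx⟩ := isCompact_univ.ultrafilter_le_nhds (U.map fun N => ν N s)
      (by simp)
    exact ⟨x, hx⟩
  choose π hπ using hlim
  have hUtop : (U : Filter ℕ) ≤ atTop := Nat.hyperfilter_le_atTop
  have hinv : Tendsto (fun N : ℕ => ((N : ℝ≥0∞) + 1)⁻¹) U (𝓝 0) := by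
    refine Tendsto.mono_left ?_ hUtop
    have := (ENNReal.tendsto_inv_nat_nhds_zero).comp (tendsto_add_atTop_nat 1)
    refine this.congr fun N => ?_
    simp
  have hle1 : ∑' s, π s ≤ 1 := by
    rw [ENNReal.tsum_eq_iSup_sum]
    refine iSup_le fun F => ?_
    refine le_of_tendsto (tendsto_finsetSum F fun s _ => hπ s) (Eventually.of_forall fun N => ?_)
    exact hν1 N ▸ ENNReal.sum_le_tsum F
  -- Tightness: by Markov's inequality the mass outside the finite set where `g` ≤ c + 1 is O(1/(c +
  -- 1)) uniformly in N, so none escapes.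
  have hge1 : 1 ≤ ∑' s, π s := by
    have hB : V s₀ + b ≠ ∞ := ENNReal.add_ne_top.2 ⟨hV s₀, hb⟩
    have h1 : ∀ c : ℕ, 1 ≤ ∑' s, π s + (V s₀ + b) * ((c : ℝ≥0∞) + 1)⁻¹ := by
      intro c
      set F := (hg (c + 1)).toFinset
      have h2 : ∀ N, 1 ≤ ∑ s ∈ F, ν N s + (V s₀ + b) * ((c : ℝ≥0∞) + 1)⁻¹ := by
        intro N
        refine (hν1 N).ge.trans ?_
        calc ∑' s, ν N s ≤ ∑' s, ((if s ∈ F then ν N s else 0) +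
              ν N s * g s * ((c : ℝ≥0∞) + 1)⁻¹) := by
              refine ENNReal.tsum_le_tsum fun s => ?_
              split_ifs with hs
              · exact le_self_add
              · have : ((c : ℝ≥0∞) + 1) ≤ g s := by
                  simp only [F, Finite.mem_toFinset, mem_ofPred_eq, not_le] at hs
                  exact_mod_cast hs.le
                rw [zero_add, mul_assoc]
                refine le_mul_of_one_le_right zero_le ?_
                refine (ENNReal.mul_inv_cancel (hc0 c) (hct c)).ge.trans ?_
                gcongr
          _ = ∑ s ∈ F, ν N s + (∑' s, ν N s * g s) * ((c : ℝ≥0∞) + 1)⁻¹ := by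
              rw [ENNReal.tsum_add, ENNReal.tsum_mul_right]
              congr 1
              rw [tsum_eq_sum (s := F) (fun s hs => if_neg hs)]
              exact Finset.sum_congr rfl fun s hs => if_pos hs
          _ ≤ _ := by
              gcongr
              exact hνg N
      have h3 : 1 ≤ ∑ s ∈ F, π s + (V s₀ + b) * ((c : ℝ≥0∞) + 1)⁻¹ :=
        ge_of_tendsto ((tendsto_finsetSum F fun s _ => hπ s).add_const _)
          (Eventually.of_forall h2)
      refine h3.trans ?_
      gcongr
      exact ENNReal.sum_le_tsum F
    have h4 : Tendsto (fun c : ℕ => ∑' s, π s + (V s₀ + b) * ((c : ℝ≥0∞) + 1)⁻¹) U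
        (𝓝 (∑' s, π s + (V s₀ + b) * 0)) :=
      (ENNReal.Tendsto.const_mul hinv (Or.inr hB)).const_add _
    rw [mul_zero, add_zero] at h4
    exact ge_of_tendsto h4 (Eventually.of_forall h1)
  have hπ1 := le_antisymm hle1 hge1
  have hKtop : ∀ s s', K s s' ≠ ∞ := fun s s' =>
    ne_top_of_le_ne_top ENNReal.one_ne_top (hK s ▸ ENNReal.le_tsum s')
  -- Only this inequality passes to the limit, through finite partial sums; equality of total masses
  -- then gives invariance.
  have hpush : ∀ s, push K π s ≤ π s := by
    intro s
    rw [push, ENNReal.tsum_eq_iSup_sum]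
    refine iSup_le fun F => ?_
    have h1 : Tendsto (fun N => ∑ s' ∈ F, ν N s' * K s' s) U (𝓝 (∑ s' ∈ F, π s' * K s' s)) :=
      tendsto_finsetSum F fun s' _ => ENNReal.Tendsto.mul_const (hπ s') (Or.inr (hKtop s' s))
    have h2 : Tendsto (fun N : ℕ => ν N s + ((N : ℝ≥0∞) + 1)⁻¹) U (𝓝 (π s + 0)) :=
      (hπ s).add hinv
    rw [add_zero] at h2
    exact le_of_tendsto_of_tendsto h1 h2 (Eventually.of_forall fun N =>
      (ENNReal.sum_le_tsum F).trans (hνpush N s))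
  refine ⟨π, hπ1, eq_of_le_of_tsum_le hpush (tsum_push hK π).ge ?_⟩
  rw [tsum_push hK, hπ1]
  exact ENNReal.one_ne_top

/-- Uniqueness of the stationary probability measure if every nonempty closed set of states
contains `s₀`. -/
theorem stationary_unique (hK : ∀ s, ∑' s', K s s' = 1) (s₀ : S)
    (hs₀ : ∀ C : Set S, C.Nonempty → (∀ s ∈ C, ∀ s', K s s' ≠ 0 → s' ∈ C) → s₀ ∈ C)
    {μ μ' : S → ℝ≥0∞} (hμ1 : ∑' s, μ s = 1) (hμ'1 : ∑' s, μ' s = 1)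
    (hμ : ∀ s, push K μ s = μ s) (hμ' : ∀ s, push K μ' s = μ' s) : μ = μ' := by
  -- The minimum dominates its push-forward, hence is invariant, and so are the two differences with
  -- it. A nonzero difference has closed support and so charges `s₀`, but one of the two vanishes at
  -- `s₀`. Thus one measure lies below the other, and their masses agree.
  set m : S → ℝ≥0∞ := fun s => min (μ s) (μ' s)
  have hm1 : ∑' s, m s ≠ ∞ := ne_top_of_le_ne_top (hμ1 ▸ ENNReal.one_ne_top)
    (ENNReal.tsum_le_tsum fun s => min_le_left _ _)
  have hmle : ∀ s, push K m s ≤ m s := fun s => le_min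
    ((push_mono (fun s => min_le_left _ _) s).trans (hμ s).le)
    ((push_mono (fun s => min_le_right _ _) s).trans (hμ' s).le)
  have hm : ∀ s, push K m s = m s :=
    eq_of_le_of_tsum_le hmle (tsum_push hK m).ge (by rwa [tsum_push hK])
  have hmt : ∀ s, m s ≠ ∞ := fun s => ne_top_of_le_ne_top hm1 (ENNReal.le_tsum s)
  have hdiff : ∀ ρ : S → ℝ≥0∞, (∀ s, push K ρ s = ρ s) → (∀ s, m s ≤ ρ s) →
      ∀ s, push K (fun s => ρ s - m s) s = ρ s - m s := by
    intro ρ hρ hle s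
    have h := push_add K (fun s => ρ s - m s) m s
    simp only [tsub_add_cancel_of_le (hle _)] at h
    rw [hm s] at h
    change push K ρ s = _ at h
    rw [hρ s] at h
    rw [h, ENNReal.add_sub_cancel_right (hmt s)]
  have hzero : ∀ ρ : S → ℝ≥0∞, (∀ s, push K ρ s = ρ s) → (∀ s, m s ≤ ρ s) →
      (∃ s, ρ s - m s ≠ 0) → ρ s₀ - m s₀ ≠ 0 := fun ρ hρ hle hex =>
    hs₀ {s | ρ s - m s ≠ 0} hex fun s hs s' hss' =>
      ne_zero_of_step (hdiff ρ hρ hle) hs hss'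
  have hor : μ s₀ - m s₀ = 0 ∨ μ' s₀ - m s₀ = 0 := by
    rcases le_total (μ s₀) (μ' s₀) with h | h
    · left; simp [m, h]
    · right; simp [m, h]
  rcases hor with h | h
  · have h1 : ∀ s, μ s ≤ μ' s := by
      intro s
      by_contra hs
      refine hzero μ hμ (fun s => min_le_left _ _) ⟨s, ?_⟩ h
      rw [Ne, tsub_eq_zero_iff_le]
      exact fun h' => hs (h'.trans (min_le_right _ _))
    exact funext (eq_of_le_of_tsum_le h1 (by rw [hμ1, hμ'1]) (hμ1 ▸ ENNReal.one_ne_top))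
  · have h1 : ∀ s, μ' s ≤ μ s := by
      intro s
      by_contra hs
      refine hzero μ' hμ' (fun s => min_le_right _ _) ⟨s, ?_⟩ h
      rw [Ne, tsub_eq_zero_iff_le]
      exact fun h' => hs (h'.trans (min_le_left _ _))
    exact (funext (eq_of_le_of_tsum_le h1 (by rw [hμ1, hμ'1]) (hμ'1 ▸ ENNReal.one_ne_top))).symm

end CountableChain

/-! ### The jump chain and its one-step expectations. -/

namespace Market

open CountableChain

/-- The parameters are admissible: positive rates, `pH ∈ (0, 1)` and `pE ∈ (0, 1]`. -/
structure Admissible (M : Market) : Prop where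
  lamH_pos : 0 < M.lamH
  lamE_pos : 0 < M.lamE
  pH_pos : 0 < M.pH
  pH_lt : M.pH < 1
  pE_pos : 0 < M.pE
  pE_le : M.pE ≤ 1

/-- Transition probabilities of the jump chain. -/
noncomputable def jump (M : Market) (s s' : MarketState) : ℝ≥0∞ :=
  ENNReal.ofReal (M.rate s s' / M.totalRate)

/-- Expectation of `f` after the arrival of a `T` agent in state `s`. -/
noncomputable def afterArrival (M : Market) (f : MarketState → ℝ) (T : AgentType)
    (s : MarketState) : ℝ :=
  M.join T s * f (s.add T) + M.matchE T s * f (s.1, s.2 - 1) + M.matchH T s * f (s.1 - 1, s.2)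

/-- Expectation of `f` after one jump from state `s`. -/
noncomputable def next (M : Market) (f : MarketState → ℝ) (s : MarketState) : ℝ :=
  M.lamH / M.totalRate * M.afterArrival f .H s + M.lamE / M.totalRate * M.afterArrival f .E s

variable {M : Market}

namespace Admissible

theorem totalRate_pos (hM : M.Admissible) : 0 < M.totalRate := add_pos hM.lamH_pos hM.lamE_pos

theorem lam_pos (hM : M.Admissible) (T : AgentType) : 0 < M.lam T := by
  cases T
  exacts [hM.lamH_pos, hM.lamE_pos]

theorem p_pos (hM : M.Admissible) (T : AgentType) : 0 < M.p T := by
  cases T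
  exacts [hM.pH_pos, hM.pE_pos]

theorem p_le (hM : M.Admissible) (T : AgentType) : M.p T ≤ 1 := by
  cases T
  exacts [hM.pH_lt.le, hM.pE_le]

theorem mul_pH_lt (hM : M.Admissible) (T : AgentType) : M.p T * M.pH < 1 :=
  mul_lt_one_of_nonneg_of_lt_one_right (hM.p_le T) hM.pH_pos.le hM.pH_lt

theorem mul_pH_pos (hM : M.Admissible) (T : AgentType) : 0 < M.p T * M.pH :=
  mul_pos (hM.p_pos T) hM.pH_pos

theorem mul_pE_pos (hM : M.Admissible) (T : AgentType) : 0 < M.p T * M.pE :=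
  mul_pos (hM.p_pos T) hM.pE_pos

theorem mul_pE_le (hM : M.Admissible) (T : AgentType) : M.p T * M.pE ≤ 1 :=
  mul_le_one₀ (hM.p_le T) hM.pE_pos.le hM.pE_le

theorem powH_pos (hM : M.Admissible) (T : AgentType) (n : ℕ) : 0 < (1 - M.p T * M.pH) ^ n :=
  pow_pos (by linarith [hM.mul_pH_lt T]) _

theorem powH_le (hM : M.Admissible) (T : AgentType) (n : ℕ) : (1 - M.p T * M.pH) ^ n ≤ 1 :=
  pow_le_one₀ (by linarith [hM.mul_pH_lt T]) (by linarith [hM.mul_pH_pos T])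

theorem powE_nonneg (hM : M.Admissible) (T : AgentType) (n : ℕ) : 0 ≤ (1 - M.p T * M.pE) ^ n :=
  pow_nonneg (by linarith [hM.mul_pE_le T]) _

theorem powE_le (hM : M.Admissible) (T : AgentType) (n : ℕ) : (1 - M.p T * M.pE) ^ n ≤ 1 :=
  pow_le_one₀ (by linarith [hM.mul_pE_le T]) (by linarith [hM.mul_pE_pos T])

theorem matchH_nonneg (hM : M.Admissible) (T : AgentType) (s : MarketState) : 0 ≤ M.matchH T s :=
  sub_nonneg.2 (hM.powH_le T _)

theorem matchE_nonneg (hM : M.Admissible) (T : AgentType) (s : MarketState) : 0 ≤ M.matchE T s :=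
  mul_nonneg (hM.powH_pos T _).le (sub_nonneg.2 (hM.powE_le T _))

theorem join_nonneg (hM : M.Admissible) (T : AgentType) (s : MarketState) : 0 ≤ M.join T s :=
  mul_nonneg (hM.powH_pos T _).le (hM.powE_nonneg T _)

theorem joinH_pos (hM : M.Admissible) (s : MarketState) : 0 < M.join .H s := by
  have := hM.mul_pH_lt .E
  exact mul_pos (hM.powH_pos .H _) (pow_pos (by simp only [p] at *; linarith [mul_comm M.pE M.pH]) _)

theorem afterArrival_nonneg (hM : M.Admissible) {f : MarketState → ℝ} (hf : ∀ s, 0 ≤ f s)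
    (T : AgentType) (s : MarketState) : 0 ≤ M.afterArrival f T s := by
  exact add_nonneg (add_nonneg (mul_nonneg (hM.join_nonneg T s) (hf _))
    (mul_nonneg (hM.matchE_nonneg T s) (hf _))) (mul_nonneg (hM.matchH_nonneg T s) (hf _))

theorem arrivalRate_nonneg (hM : M.Admissible) (T : AgentType) (s s' : MarketState) :
    0 ≤ M.arrivalRate T s s' := by
  have := hM.join_nonneg T s
  have := hM.matchE_nonneg T s
  have := hM.matchH_nonneg T s
  refine mul_nonneg (hM.lam_pos T).le ?_
  split_ifs <;> positivity

theorem rate_nonneg (hM : M.Admissible) (s s' : MarketState) : 0 ≤ M.rate s s' :=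
  add_nonneg (hM.arrivalRate_nonneg _ _ _) (hM.arrivalRate_nonneg _ _ _)

end Admissible

theorem matchH_zero (T : AgentType) (e : ℕ) : M.matchH T (0, e) = 0 := by simp [matchH]

theorem matchE_zero (T : AgentType) (h : ℕ) : M.matchE T (h, 0) = 0 := by simp [matchE]

theorem join_add_matchE_add_matchH (T : AgentType) (s : MarketState) :
    M.join T s + M.matchE T s + M.matchH T s = 1 := by
  unfold join matchE matchH
  ring

theorem hasSum_arrivalRate_mul (f : MarketState → ℝ) (T : AgentType) (s : MarketState) :
    HasSum (fun s' => M.arrivalRate T s s' * f s') (M.lam T * M.afterArrival f T s) := by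
  have h1 : HasSum (fun s' => (if s' = s.add T then M.join T s else 0) * f s')
      (M.join T s * f (s.add T)) := by
    convert hasSum_single (s.add T) ?_ using 1
    · simp
    · intro s' hs'
      simp [hs']
  have h2 : HasSum (fun s' : MarketState => (if s'.add .H = s then M.matchH T s else 0) * f s')
      (M.matchH T s * f (s.1 - 1, s.2)) := by
    obtain ⟨_ | h, e⟩ := s
    · simp [matchH_zero, hasSum_zero]
    · convert hasSum_single ((h, e) : MarketState) ?_ using 1
      · simp [MarketState.add]
      · rintro ⟨h', e'⟩ hs'
        have : ¬ (MarketState.add (h', e') .H = (h + 1, e)) := by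
          simpa [MarketState.add] using hs'
        simp [this]
  have h3 : HasSum (fun s' : MarketState => (if s'.add .E = s then M.matchE T s else 0) * f s')
      (M.matchE T s * f (s.1, s.2 - 1)) := by
    obtain ⟨h, _ | e⟩ := s
    · simp [matchE_zero, hasSum_zero]
    · convert hasSum_single ((h, e) : MarketState) ?_ using 1
      · simp [MarketState.add]
      · rintro ⟨h', e'⟩ hs'
        have : ¬ (MarketState.add (h', e') .E = (h, e + 1)) := by
          simpa [MarketState.add] using hs'
        simp [this]
  have h := ((h1.add h3).add h2).mul_left (M.lam T)
  refine h.congr_fun fun s' => ?_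
  unfold arrivalRate
  ring

theorem hasSum_rate_mul (f : MarketState → ℝ) (s : MarketState) :
    HasSum (fun s' => M.rate s s' / M.totalRate * f s') (M.next f s) := by
  have h := ((M.hasSum_arrivalRate_mul f .H s).add (M.hasSum_arrivalRate_mul f .E s)).div_const
    M.totalRate
  have h1 : M.next f s = (M.lam .H * M.afterArrival f .H s + M.lam .E * M.afterArrival f .E s) /
      M.totalRate := by
    unfold next lam
    ring
  rw [h1]
  refine h.congr_fun fun s' => ?_
  unfold rate
  ring

namespace Admissible

theorem tsum_jump_mul (hM : M.Admissible) {f : MarketState → ℝ} (hf : ∀ s, 0 ≤ f s)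
    (s : MarketState) :
    ∑' s', M.jump s s' * ENNReal.ofReal (f s') = ENNReal.ofReal (M.next f s) := by
  have h0 : ∀ s', 0 ≤ M.rate s s' / M.totalRate := fun s' =>
    div_nonneg (hM.rate_nonneg _ _) hM.totalRate_pos.le
  rw [← (M.hasSum_rate_mul f s).tsum_eq, ENNReal.ofReal_tsum_of_nonneg
    (fun s' => mul_nonneg (h0 s') (hf s')) (M.hasSum_rate_mul f s).summable]
  exact tsum_congr fun s' => (ENNReal.ofReal_mul (h0 s')).symm

theorem next_one (hM : M.Admissible) (s : MarketState) : M.next (fun _ => 1) s = 1 := by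
  have := hM.totalRate_pos
  simp only [next, afterArrival, mul_one, join_add_matchE_add_matchH]
  rw [← add_div]
  exact div_self this.ne'

theorem tsum_jump (hM : M.Admissible) (s : MarketState) : ∑' s', M.jump s s' = 1 := by
  simpa [hM.next_one] using hM.tsum_jump_mul (f := fun _ => 1) (fun _ => zero_le_one) s

theorem ofReal_rate (hM : M.Admissible) (s s' : MarketState) :
    ENNReal.ofReal (M.rate s s') = M.jump s s' * ENNReal.ofReal M.totalRate := by
  have := hM.totalRate_pos
  rw [jump, ← ENNReal.ofReal_mul (div_nonneg (hM.rate_nonneg _ _) this.le),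
    div_mul_cancel₀ _ this.ne']

/-- The exit rate is the same in every state, so balance of flows is invariance under the jump chain
multiplied by `totalRate`. -/
theorem isSteadyState_iff (hM : M.Admissible) (μ : PMF MarketState) :
    M.IsSteadyState μ ↔ ∀ s, push M.jump μ s = μ s := by
  have h0 : ENNReal.ofReal M.totalRate ≠ 0 := by simpa using hM.totalRate_pos
  simp only [IsSteadyState, hM.ofReal_rate, ← mul_assoc, ENNReal.tsum_mul_right, push,
    hM.tsum_jump, one_mul]
  exact forall_congr' fun s => ENNReal.mul_left_inj h0 ENNReal.ofReal_ne_top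

/-- The jump chain leads from every state to the empty market. -/
theorem empty_mem_of_closed (hM : M.Admissible) {C : Set MarketState} (hC : C.Nonempty)
    (hcl : ∀ s ∈ C, ∀ s', M.jump s s' ≠ 0 → s' ∈ C) : ((0, 0) : MarketState) ∈ C := by
  have hpos : ∀ s s', 0 < M.rate s s' → M.jump s s' ≠ 0 := fun s s' h => by
    simpa [jump] using div_pos h hM.totalRate_pos
  have hH : ∀ h e, ((h + 1, e) : MarketState) ∈ C → (h, e) ∈ C := by
    intro h e hC
    refine hcl _ hC _ (hpos _ _ (add_pos_of_pos_of_nonneg ?_ (hM.arrivalRate_nonneg _ _ _)))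
    refine mul_pos (hM.lam_pos _) ?_
    have h1 : 0 < M.matchH .H (h + 1, e) :=
      sub_pos.2 (pow_lt_one₀ (by linarith [hM.mul_pH_lt .H]) (by linarith [hM.mul_pH_pos .H])
        (by simp))
    have := hM.join_nonneg .H (h + 1, e)
    have := hM.matchE_nonneg .H (h + 1, e)
    rw [if_pos (show MarketState.add (h, e) .H = (h + 1, e) from rfl)]
    split_ifs <;> positivity
  have hE : ∀ e, ((0, e + 1) : MarketState) ∈ C → (0, e) ∈ C := by
    intro e hC
    refine hcl _ hC _ (hpos _ _ (add_pos_of_nonneg_of_pos (hM.arrivalRate_nonneg _ _ _) ?_))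
    refine mul_pos (hM.lam_pos _) ?_
    have h1 : 0 < M.matchE .E (0, e + 1) :=
      mul_pos (hM.powH_pos .E _) (sub_pos.2 (pow_lt_one₀ (by linarith [hM.mul_pE_le .E])
        (by linarith [hM.mul_pE_pos .E]) (by simp)))
    have := hM.join_nonneg .E (0, e + 1)
    have := hM.matchH_nonneg .E (0, e + 1)
    rw [if_pos (show MarketState.add (0, e) .E = (0, e + 1) from rfl)]
    split_ifs <;> positivity
  obtain ⟨⟨h, e⟩, hs⟩ := hC
  have h1 : ((0, e) : MarketState) ∈ C := by
    induction h with
    | zero => exact hs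
    | succ h ih => exact ih (hH h e hs)
  clear hs
  induction e with
  | zero => exact h1
  | succ e ih => exact ih (hE e h1)

/-- Drift condition in real numbers. -/
theorem drift (hM : M.Admissible) {V g : MarketState → ℝ} {b : ℝ} (hV : ∀ s, 0 ≤ V s)
    (hg : ∀ s, 0 ≤ g s) (hb : 0 ≤ b) (h : ∀ s, M.next V s + g s ≤ V s + b) (s : MarketState) :
    ∑' s', M.jump s s' * ENNReal.ofReal (V s') + ENNReal.ofReal (g s)
      ≤ ENNReal.ofReal (V s) + ENNReal.ofReal b := by
  have h0 : 0 ≤ M.next V s := add_nonneg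
    (mul_nonneg (div_nonneg hM.lamH_pos.le hM.totalRate_pos.le) (hM.afterArrival_nonneg hV _ _))
    (mul_nonneg (div_nonneg hM.lamE_pos.le hM.totalRate_pos.le) (hM.afterArrival_nonneg hV _ _))
  rw [hM.tsum_jump_mul hV, ← ENNReal.ofReal_add h0 (hg s), ← ENNReal.ofReal_add (hV s) hb]
  exact ENNReal.ofReal_le_ofReal (h s)

theorem tsum_mul_le_of_drift (hM : M.Admissible) {μ : PMF MarketState} (hμ : M.IsSteadyState μ)
    {V g : MarketState → ℝ} {b : ℝ} (hV : ∀ s, 0 ≤ V s)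
    (hg : ∀ s, 0 ≤ g s) (hb : 0 ≤ b) (h : ∀ s, M.next V s + g s ≤ V s + b) :
    ∑' s, μ s * ENNReal.ofReal (g s) ≤ ENNReal.ofReal b :=
  CountableChain.tsum_mul_le_of_drift hM.tsum_jump ((hM.isSteadyState_iff μ).1 hμ) μ.tsum_coe
    (V := fun s => ENNReal.ofReal (V s)) (fun _ => ENNReal.ofReal_ne_top) (hM.drift hV hg hb h)

end Admissible

/-! ### Existence and uniqueness of the steady state, and finiteness of the mean queue. -/

theorem matchH_mul_cast_pred (T : AgentType) (s : MarketState) (F : ℝ → ℝ) :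
    M.matchH T s * F ((s.1 - 1 : ℕ) : ℝ) = M.matchH T s * F ((s.1 : ℝ) - 1) := by
  obtain ⟨_ | h, e⟩ := s <;> simp [matchH_zero]

theorem matchE_mul_cast_pred (T : AgentType) (s : MarketState) (F : ℝ → ℝ) :
    M.matchE T s * F ((s.2 - 1 : ℕ) : ℝ) = M.matchE T s * F ((s.2 : ℝ) - 1) := by
  obtain ⟨h, _ | e⟩ := s <;> simp [matchE_zero]

/-- One-step expectations of functions given by a formula on real arguments, without truncated
subtraction. -/
theorem afterArrival_formula (F : ℝ → ℝ → ℝ) (T : AgentType) (s : MarketState) :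
    M.afterArrival (fun s => F s.1 s.2) T s =
      M.join T s * F (s.add T).1 (s.add T).2 + M.matchE T s * F s.1 (s.2 - 1) +
        M.matchH T s * F (s.1 - 1) s.2 := by
  unfold afterArrival
  rw [M.matchE_mul_cast_pred T s (fun x => F s.1 x), M.matchH_mul_cast_pred T s (fun x => F x s.2)]

/-- Compare (1 - q)^n with exp(-qn) and use x exp(-x) ≤ 1. -/
theorem pow_mul_le {q : ℝ} (hq : 0 < q) (hq1 : q ≤ 1) (n : ℕ) : (1 - q) ^ n * n ≤ q⁻¹ := by
  have h1 : (1 - q) ^ n ≤ Real.exp (-(q * n)) := by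
    have : (1 - q) ^ n ≤ (Real.exp (-q)) ^ n :=
      pow_le_pow_left₀ (by linarith) (by linarith [Real.add_one_le_exp (-q)]) _
    rwa [← Real.exp_nat_mul, show (n : ℝ) * -q = -(q * n) by ring] at this
  have h2 : q * n * Real.exp (-(q * n)) ≤ 1 := by
    rw [Real.exp_neg, ← div_eq_mul_inv, div_le_one (Real.exp_pos _)]
    linarith [Real.add_one_le_exp (q * n)]
  rw [← one_div, le_div_iff₀ hq]
  calc (1 - q) ^ n * n * q ≤ Real.exp (-(q * n)) * n * q := by gcongr
    _ = q * n * Real.exp (-(q * n)) := by ring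
    _ ≤ 1 := h2

namespace Admissible

theorem join_mul_le (hM : M.Admissible) (T : AgentType) (s : MarketState) :
    M.join T s * (s.1 + s.2) ≤ (M.p T * M.pH)⁻¹ + (M.p T * M.pE)⁻¹ := by
  have h1 := pow_mul_le (hM.mul_pH_pos T) (hM.mul_pH_lt T).le s.1
  have h2 := pow_mul_le (hM.mul_pE_pos T) (hM.mul_pE_le T) s.2
  have h3 := hM.powH_pos T s.1
  have h4 := hM.powE_nonneg T s.2
  have h5 := hM.powH_le T s.1
  have h6 := hM.powE_le T s.2
  unfold join
  calc _ = ((1 - M.p T * M.pH) ^ s.1 * s.1) * (1 - M.p T * M.pE) ^ s.2 +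
        (1 - M.p T * M.pH) ^ s.1 * ((1 - M.p T * M.pE) ^ s.2 * s.2) := by ring
    _ ≤ ((1 - M.p T * M.pH) ^ s.1 * s.1) * 1 + 1 * ((1 - M.p T * M.pE) ^ s.2 * s.2) := by gcongr
    _ ≤ _ := by linarith

/-- Quadratic Lyapunov function: the second moment of the number of waiting agents decreases on
average away from a finite set. -/
theorem exists_drift_sq (hM : M.Admissible) : ∃ b : ℝ, 0 ≤ b ∧ ∀ s : MarketState,
    M.next (fun s => ((s.1 : ℝ) + s.2) ^ 2) s + 2 * ((s.1 : ℝ) + s.2) ≤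
      ((s.1 : ℝ) + s.2) ^ 2 + b := by
  have hΛ := hM.totalRate_pos
  set α := M.lamH / M.totalRate with hα
  set β := M.lamE / M.totalRate with hβ
  have hα0 : 0 ≤ α := div_nonneg hM.lamH_pos.le hΛ.le
  have hβ0 : 0 ≤ β := div_nonneg hM.lamE_pos.le hΛ.le
  have hαβ : α + β = 1 := by
    rw [hα, hβ, ← add_div]
    exact div_self hΛ.ne'
  set B : AgentType → ℝ := fun T => (M.p T * M.pH)⁻¹ + (M.p T * M.pE)⁻¹
  have hB : ∀ T, 0 ≤ B T := fun T => by
    have := hM.mul_pH_pos T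
    have := hM.mul_pE_pos T
    positivity
  -- The total n goes up by one with the joining probability j and down by one otherwise, so n²
  -- changes in mean by 1 - 2n + 4jn, where jn ≤ `B T`.
  have hT : ∀ T s, M.afterArrival (fun s => ((s.1 : ℝ) + s.2) ^ 2) T s ≤
      ((s.1 : ℝ) + s.2) ^ 2 + 1 - 2 * ((s.1 : ℝ) + s.2) + 4 * B T := by
    intro T s
    rw [M.afterArrival_formula (fun x y => (x + y) ^ 2)]
    have hadd : (((s.add T).1 : ℝ) + ((s.add T).2 : ℝ)) = (s.1 : ℝ) + s.2 + 1 := by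
      cases T <;> simp [MarketState.add] <;> ring
    have hj := hM.join_mul_le T s
    rw [hadd]
    have h1 : M.matchE T s = 1 - M.join T s - M.matchH T s := by
      linarith [M.join_add_matchE_add_matchH T s]
    rw [h1]
    simp only [B]
    nlinarith
  refine ⟨1 + 4 * (α * B .H + β * B .E), by have := hB .H; have := hB .E; positivity, fun s => ?_⟩
  have h1 := mul_le_mul_of_nonneg_left (hT .H s) hα0
  have h2 := mul_le_mul_of_nonneg_left (hT .E s) hβ0
  have h3 : β = 1 - α := by linarith
  rw [next, ← hα, ← hβ]
  rw [h3] at h2 ⊢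
  linarith

theorem exists_steadyState (hM : M.Admissible) : ∃ μ, M.IsSteadyState μ := by
  obtain ⟨b, hb, h⟩ := hM.exists_drift_sq
  obtain ⟨π, hπ1, hπ⟩ := exists_stationary (K := M.jump) hM.tsum_jump
    (V := fun s => ENNReal.ofReal (((s.1 : ℝ) + s.2) ^ 2))
    (g := fun s => ENNReal.ofReal (2 * ((s.1 : ℝ) + s.2))) (b := ENNReal.ofReal b)
    (fun _ => ENNReal.ofReal_ne_top) ENNReal.ofReal_ne_top
    (fun c => by
      refine ((finite_Iic c).prod (finite_Iic c)).subset ?_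
      rintro ⟨h, e⟩ hs
      have hs' : ENNReal.ofReal (2 * ((h : ℝ) + e)) ≤ c := hs
      rw [ENNReal.ofReal_le_natCast] at hs'
      have : 2 * (h + e) ≤ c := by exact_mod_cast hs'
      constructor <;> simp <;> omega)
    (hM.drift (V := fun s => ((s.1 : ℝ) + s.2) ^ 2) (g := fun s => 2 * ((s.1 : ℝ) + s.2))
      (fun _ => by positivity) (fun _ => by positivity) hb h)
  let μ : PMF MarketState := ⟨π, hπ1 ▸ ENNReal.summable.hasSum⟩
  exact ⟨μ, (hM.isSteadyState_iff μ).2 hπ⟩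

theorem steadyState_unique (hM : M.Admissible) {μ μ' : PMF MarketState} (h : M.IsSteadyState μ)
    (h' : M.IsSteadyState μ') : μ = μ' :=
  DFunLike.coe_injective <| stationary_unique hM.tsum_jump (0, 0)
    (fun _ hC hcl => hM.empty_mem_of_closed hC hcl) μ.tsum_coe μ'.tsum_coe
    ((hM.isSteadyState_iff μ).1 h) ((hM.isSteadyState_iff μ').1 h')

theorem tsum_waitingH_ne_top (hM : M.Admissible) {μ : PMF MarketState} (hμ : M.IsSteadyState μ) :
    ∑' s, μ s * (s.1 : ℝ≥0∞) ≠ ∞ := by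
  obtain ⟨b, hb, h⟩ := hM.exists_drift_sq
  refine ne_top_of_le_ne_top ENNReal.ofReal_ne_top (le_trans (ENNReal.tsum_le_tsum fun s => ?_)
    (hM.tsum_mul_le_of_drift hμ (V := fun s => ((s.1 : ℝ) + s.2) ^ 2)
      (g := fun s => 2 * ((s.1 : ℝ) + s.2)) (fun _ => by positivity) (fun _ => by positivity) hb h))
  gcongr
  rw [← ENNReal.ofReal_natCast]
  refine ENNReal.ofReal_le_ofReal ?_
  have : (0 : ℝ) ≤ s.1 := by positivity
  have : (0 : ℝ) ≤ s.2 := by positivity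
  linarith

end Admissible

end Market

/-! ### Little's law. -/

namespace Market

open CountableChain MeasureTheory

variable {M : Market}

theorem unmatched_succ (n : ℕ) (s : MarketState) : M.unmatched (n + 1) s =
    M.lamH / M.totalRate * (M.join .H s * M.unmatched n (s.add .H) +
      M.matchE .H s * M.unmatched n (s.1, s.2 - 1) +
      M.matchH .H s * (1 - 1 / (s.1 : ℝ)) * M.unmatched n (s.1 - 1, s.2)) +
    M.lamE / M.totalRate * (M.join .E s * M.unmatched n (s.add .E) +
      M.matchE .E s * M.unmatched n (s.1, s.2 - 1) +
      M.matchH .E s * (1 - 1 / (s.1 : ℝ)) * M.unmatched n (s.1 - 1, s.2)) := rfl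

theorem lintegral_poisson {r : ℝ} (hr : 0 < r) (n : ℕ) :
    ∫⁻ t in Ioi (0 : ℝ), ENNReal.ofReal (Real.exp (-(r * t)) * (r * t) ^ n / (n ! : ℝ)) =
      ENNReal.ofReal r⁻¹ := by
  have hg := ProbabilityTheory.lintegral_gammaPDF_eq_one (a := (n : ℝ) + 1) (r := r)
    (by positivity) hr
  have h1 : ∀ t ∈ Ioi (0 : ℝ), ENNReal.ofReal (Real.exp (-(r * t)) * (r * t) ^ n / (n ! : ℝ)) =
      ENNReal.ofReal r⁻¹ * ProbabilityTheory.gammaPDF ((n : ℝ) + 1) r t := by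
    intro t ht
    rw [ProbabilityTheory.gammaPDF_of_nonneg (le_of_lt ht),
      ← ENNReal.ofReal_mul (inv_nonneg.2 hr.le)]
    congr 1
    rw [Real.Gamma_nat_eq_factorial, add_sub_cancel_right, Real.rpow_natCast,
      show (n : ℝ) + 1 = ((n + 1 : ℕ) : ℝ) by push_cast; ring, Real.rpow_natCast, mul_pow, pow_succ]
    have : (n ! : ℝ) ≠ 0 := by positivity
    field_simp
  have h2 : ∫⁻ t in Ioi (0 : ℝ), ProbabilityTheory.gammaPDF ((n : ℝ) + 1) r t = 1 := by
    rwa [← lintegral_add_compl _ (measurableSet_Ioi (a := (0 : ℝ))), compl_Ioi,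
      ← setLIntegral_congr Iio_ae_eq_Iic, ProbabilityTheory.lintegral_gammaPDF_of_nonpos le_rfl,
      add_zero] at hg
  rw [setLIntegral_congr_fun measurableSet_Ioi h1, lintegral_const_mul' _ _ ENNReal.ofReal_ne_top,
    h2, mul_one]

/-- Probability that an `H` agent arriving in the distribution `μ` waits, and is still waiting after
`n` further arrivals. -/
noncomputable def waiting (M : Market) (μ : PMF MarketState) (n : ℕ) : ℝ≥0∞ :=
  ∑' s, μ s * ENNReal.ofReal (M.join .H s) * ENNReal.ofReal (M.unmatched n (s.add .H))

namespace Admissible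

theorem one_sub_inv_natCast_nonneg (n : ℕ) : 0 ≤ 1 - 1 / (n : ℝ) := by
  rcases Nat.eq_zero_or_pos n with rfl | h
  · simp
  · rw [sub_nonneg, div_le_one (by exact_mod_cast h)]
    exact_mod_cast h

theorem unmatched_nonneg (hM : M.Admissible) (n : ℕ) : ∀ s, 0 ≤ M.unmatched n s := by
  induction n with
  | zero => exact fun _ => zero_le_one
  | succ n ih =>
    intro s
    have hc := one_sub_inv_natCast_nonneg s.1
    have hΛ := hM.totalRate_pos
    have h : ∀ T, 0 ≤ M.join T s * M.unmatched n (s.add T) +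
        M.matchE T s * M.unmatched n (s.1, s.2 - 1) +
        M.matchH T s * (1 - 1 / (s.1 : ℝ)) * M.unmatched n (s.1 - 1, s.2) := fun T =>
      add_nonneg (add_nonneg (mul_nonneg (hM.join_nonneg T s) (ih _))
        (mul_nonneg (hM.matchE_nonneg T s) (ih _)))
        (mul_nonneg (mul_nonneg (hM.matchH_nonneg T s) hc) (ih _))
    exact add_nonneg (mul_nonneg (div_nonneg hM.lamH_pos.le hΛ.le) (h _))
      (mul_nonneg (div_nonneg hM.lamE_pos.le hΛ.le) (h _))

theorem unmatched_le_one (hM : M.Admissible) (n : ℕ) : ∀ s, M.unmatched n s ≤ 1 := by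
  induction n with
  | zero => exact fun _ => le_rfl
  | succ n ih =>
    intro s
    have hc := one_sub_inv_natCast_nonneg s.1
    have hc1 : 1 - 1 / (s.1 : ℝ) ≤ 1 := sub_le_self _ (by positivity)
    have hΛ := hM.totalRate_pos
    have h : ∀ T, M.join T s * M.unmatched n (s.add T) +
        M.matchE T s * M.unmatched n (s.1, s.2 - 1) +
        M.matchH T s * (1 - 1 / (s.1 : ℝ)) * M.unmatched n (s.1 - 1, s.2) ≤ 1 := by
      intro T
      have h1 := hM.join_nonneg T s
      have h2 := hM.matchE_nonneg T s
      have h3 := hM.matchH_nonneg T s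
      have h4 := hM.unmatched_nonneg n (s.1 - 1, s.2)
      calc _ ≤ M.join T s * 1 + M.matchE T s * 1 + M.matchH T s * 1 * 1 := by
            gcongr <;> exact ih _
        _ = 1 := by rw [mul_one, mul_one, mul_one, mul_one, join_add_matchE_add_matchH]
    have hα : 0 ≤ M.lamH / M.totalRate := div_nonneg hM.lamH_pos.le hΛ.le
    have hβ : 0 ≤ M.lamE / M.totalRate := div_nonneg hM.lamE_pos.le hΛ.le
    rw [unmatched_succ]
    calc _ ≤ M.lamH / M.totalRate * 1 + M.lamE / M.totalRate * 1 := by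
          gcongr <;> exact h _
      _ = 1 := by
          rw [mul_one, mul_one, ← add_div]
          exact div_self hΛ.ne'

/-- The expected number of `H` agents present after the first arrival who stay unmatched for `n`
further arrivals: those present before it, and possibly the newcomer. -/
theorem next_mul_unmatched (n : ℕ) (s : MarketState) :
    M.next (fun s => s.1 * M.unmatched n s) s = s.1 * M.unmatched (n + 1) s +
      M.lamH / M.totalRate * (M.join .H s * M.unmatched n (s.add .H)) := by
  rw [unmatched_succ]
  obtain ⟨_ | h, e⟩ := s
  · simp [next, afterArrival, matchH_zero, MarketState.add]
  · have : ((h : ℝ) + 1) ≠ 0 := by positivity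
    simp only [next, afterArrival, MarketState.add, Nat.add_sub_cancel]
    push_cast
    field_simp
    ring

variable {μ : PMF MarketState}

/-- Invariance cancels the effect of one arrival on the law of the state; what remains is a
difference in n that telescopes. -/
theorem tsum_mul_unmatched (hM : M.Admissible) (hμ : M.IsSteadyState μ) (n : ℕ) :
    ∑' s, μ s * ENNReal.ofReal (s.1 * M.unmatched n s) =
      ∑' s, μ s * ENNReal.ofReal (s.1 * M.unmatched (n + 1) s) +
        ENNReal.ofReal (M.lamH / M.totalRate) * M.waiting μ n := by
  have h0 : ∀ n s, 0 ≤ (s.1 : ℝ) * M.unmatched n s := fun n s =>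
    mul_nonneg (Nat.cast_nonneg _) (hM.unmatched_nonneg n s)
  have hα : 0 ≤ M.lamH / M.totalRate := div_nonneg hM.lamH_pos.le hM.totalRate_pos.le
  have h1 := tsum_push_mul M.jump μ fun s => ENNReal.ofReal (s.1 * M.unmatched n s)
  simp only [(hM.isSteadyState_iff μ).1 hμ] at h1
  rw [h1, waiting, ← ENNReal.tsum_mul_left, ← ENNReal.tsum_add]
  refine tsum_congr fun s => ?_
  have hj := hM.join_nonneg .H s
  rw [hM.tsum_jump_mul (h0 n), next_mul_unmatched, ENNReal.ofReal_add (h0 _ _)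
    (mul_nonneg hα (mul_nonneg hj (hM.unmatched_nonneg _ _))), ENNReal.ofReal_mul hα,
    ENNReal.ofReal_mul hj]
  ring

theorem tsum_waitingH_eq (hM : M.Admissible) (hμ : M.IsSteadyState μ) (N : ℕ) :
    ∑' s, μ s * (s.1 : ℝ≥0∞) = ∑' s, μ s * ENNReal.ofReal (s.1 * M.unmatched N s) +
      ENNReal.ofReal (M.lamH / M.totalRate) * ∑ n ∈ Finset.range N, M.waiting μ n := by
  induction N with
  | zero => simp [unmatched]
  | succ N ih => rw [ih, hM.tsum_mul_unmatched hμ N, Finset.sum_range_succ]; ring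

theorem ofReal_lamH_div_ne_zero (hM : M.Admissible) :
    ENNReal.ofReal (M.lamH / M.totalRate) ≠ 0 := by
  simpa using div_pos hM.lamH_pos hM.totalRate_pos

theorem tsum_waiting_ne_top (hM : M.Admissible) (hμ : M.IsSteadyState μ) :
    ∑' n, M.waiting μ n ≠ ∞ := by
  have h : ENNReal.ofReal (M.lamH / M.totalRate) * ∑' n, M.waiting μ n ≤
      ∑' s, μ s * (s.1 : ℝ≥0∞) := by
    rw [← ENNReal.tsum_mul_left, ENNReal.tsum_eq_iSup_nat]
    refine iSup_le fun N => ?_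
    rw [hM.tsum_waitingH_eq hμ N, Finset.mul_sum]
    exact le_add_self
  intro htop
  rw [htop, ENNReal.mul_top hM.ofReal_lamH_div_ne_zero] at h
  exact hM.tsum_waitingH_ne_top hμ (top_le_iff.1 h)

/-- A waiting agent is matched eventually. -/
theorem tendsto_mul_unmatched (hM : M.Admissible) (hμ : M.IsSteadyState μ) (s : MarketState) :
    Tendsto (fun n => μ s * ENNReal.ofReal (s.1 * M.unmatched n s)) atTop (𝓝 0) := by
  obtain ⟨_ | h, e⟩ := s
  · simp
  by_cases hs : μ (h + 1, e) = 0
  · simp [hs]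
  -- A match leads from (h + 1, e) to (h, e), which thus has positive mass. An `H` agent joining
  -- there becomes the tagged agent in (h + 1, e), so `unmatched` at that state is bounded by a
  -- multiple of the terms of the convergent series of `waiting`.
  have hs' : μ (h, e) ≠ 0 := by
    refine ne_zero_of_step ((hM.isSteadyState_iff μ).1 hμ) hs ?_
    have h1 : 0 < M.matchH .H (h + 1, e) :=
      sub_pos.2 (pow_lt_one₀ (by linarith [hM.mul_pH_lt .H]) (by linarith [hM.mul_pH_pos .H])
        (by simp))
    have := hM.join_nonneg .H (h + 1, e)
    have := hM.matchE_nonneg .H (h + 1, e)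
    have h2 : 0 < M.rate (h + 1, e) (h, e) := by
      refine add_pos_of_pos_of_nonneg (mul_pos (hM.lam_pos _) ?_) (hM.arrivalRate_nonneg _ _ _)
      rw [if_pos (show MarketState.add (h, e) .H = (h + 1, e) from rfl)]
      split_ifs <;> positivity
    simpa [jump] using div_pos h2 hM.totalRate_pos
  set c : ℝ≥0∞ := μ (h, e) * ENNReal.ofReal (M.join .H (h, e)) with hc
  have hc0 : c ≠ 0 := mul_ne_zero hs' (by simpa using hM.joinH_pos (h, e))
  have hct : c ≠ ∞ := ENNReal.mul_ne_top (μ.apply_ne_top _) ENNReal.ofReal_ne_top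
  have h0 := ENNReal.tendsto_atTop_zero_of_tsum_ne_top (hM.tsum_waiting_ne_top hμ)
  have h1 : Tendsto (fun n => c * ENNReal.ofReal (M.unmatched n (h + 1, e))) atTop (𝓝 0) :=
    tendsto_of_tendsto_of_tendsto_of_le_of_le tendsto_const_nhds h0 (fun _ => zero_le)
      fun n => ENNReal.le_tsum (f := fun s => μ s * ENNReal.ofReal (M.join .H s) *
        ENNReal.ofReal (M.unmatched n (s.add .H))) ((h, e) : MarketState)
  have h2 := ENNReal.Tendsto.const_mul (a := μ (h + 1, e) * ENNReal.ofReal ((h + 1 : ℕ) : ℝ) * c⁻¹)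
    h1 (Or.inr (ENNReal.mul_ne_top (ENNReal.mul_ne_top (μ.apply_ne_top _) ENNReal.ofReal_ne_top)
      (ENNReal.inv_ne_top.2 hc0)))
  rw [mul_zero] at h2
  refine h2.congr fun n => ?_
  rw [ENNReal.ofReal_mul (Nat.cast_nonneg _)]
  calc _ = μ (h + 1, e) * ENNReal.ofReal ((h + 1 : ℕ) : ℝ) * (c⁻¹ * c) *
        ENNReal.ofReal (M.unmatched n (h + 1, e)) := by ring
    _ = _ := by rw [ENNReal.inv_mul_cancel hc0 hct, mul_one, mul_assoc]

/-- Dominated convergence, with the finite mean queue as the dominating sum; the remainder of the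
telescoped identity disappears. -/
theorem tendsto_tsum_mul_unmatched (hM : M.Admissible) (hμ : M.IsSteadyState μ) :
    Tendsto (fun n => ∑' s, μ s * ENNReal.ofReal (s.1 * M.unmatched n s)) atTop (𝓝 0) := by
  have h := tendsto_lintegral_of_dominated_convergence (μ := (Measure.count : Measure MarketState))
    (F := fun n s => μ s * ENNReal.ofReal (s.1 * M.unmatched n s)) (f := fun _ => 0)
    (fun s => μ s * (s.1 : ℝ≥0∞)) (fun n => measurable_of_countable _)
    (fun n => Eventually.of_forall fun s => ?_) ?_
    (Eventually.of_forall (hM.tendsto_mul_unmatched hμ))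
  · simpa [lintegral_count] using h
  · simp only
    gcongr
    rw [← ENNReal.ofReal_natCast]
    exact ENNReal.ofReal_le_ofReal
      (mul_le_of_le_one_right (Nat.cast_nonneg _) (hM.unmatched_le_one _ _))
  · rw [lintegral_count]
    exact hM.tsum_waitingH_ne_top hμ

theorem lamH_div_mul_tsum_waiting (hM : M.Admissible) (hμ : M.IsSteadyState μ) :
    ENNReal.ofReal (M.lamH / M.totalRate) * ∑' n, M.waiting μ n = ∑' s, μ s * (s.1 : ℝ≥0∞) := by
  have h1 : Tendsto (fun N => ∑' s, μ s * ENNReal.ofReal (s.1 * M.unmatched N s) +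
      ENNReal.ofReal (M.lamH / M.totalRate) * ∑ n ∈ Finset.range N, M.waiting μ n) atTop
      (𝓝 (0 + ENNReal.ofReal (M.lamH / M.totalRate) * ∑' n, M.waiting μ n)) :=
    (hM.tendsto_tsum_mul_unmatched hμ).add
      (ENNReal.Tendsto.const_mul (ENNReal.tendsto_nat_tsum _) (Or.inr ENNReal.ofReal_ne_top))
  simp only [← hM.tsum_waitingH_eq hμ] at h1
  rw [zero_add] at h1
  exact tendsto_nhds_unique h1 tendsto_const_nhds

/-- Each Poisson weight integrates over time to the mean gap 1/`totalRate` between arrivals. -/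
theorem meanWaitH_eq_tsum (hM : M.Admissible) (μ : PMF MarketState) :
    M.meanWaitH μ = ENNReal.ofReal M.totalRate⁻¹ * ∑' n, M.waiting μ n := by
  have hmeas : ∀ n : ℕ, Measurable fun t : ℝ => ENNReal.ofReal
      (Real.exp (-(M.totalRate * t)) * (M.totalRate * t) ^ n / (n ! : ℝ)) := fun n => by fun_prop
  unfold meanWaitH waitTailH waiting
  rw [lintegral_tsum fun s => (Measurable.const_mul (Measurable.tsum fun n =>
    (hmeas n).mul_const _) _).aemeasurable]
  have h1 : ∀ s : MarketState, ∫⁻ t in Ioi (0 : ℝ), μ s * ENNReal.ofReal (M.join .H s) *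
      ∑' n : ℕ, ENNReal.ofReal (Real.exp (-(M.totalRate * t)) * (M.totalRate * t) ^ n / (n ! : ℝ)) *
        ENNReal.ofReal (M.unmatched n (s.add .H)) =
      ∑' n, ENNReal.ofReal M.totalRate⁻¹ * (μ s * ENNReal.ofReal (M.join .H s) *
        ENNReal.ofReal (M.unmatched n (s.add .H))) := by
    intro s
    rw [lintegral_const_mul _ (Measurable.tsum fun n => (hmeas n).mul_const _),
      lintegral_tsum fun n => ((hmeas n).mul_const _).aemeasurable, ← ENNReal.tsum_mul_left]
    refine tsum_congr fun n => ?_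
    rw [lintegral_mul_const _ (hmeas n), lintegral_poisson hM.totalRate_pos]
    ring
  simp only [h1]
  rw [ENNReal.tsum_comm, ← ENNReal.tsum_mul_left]
  exact tsum_congr fun n => ENNReal.tsum_mul_left

/-- Little's law. -/
theorem meanWaitH_eq (hM : M.Admissible) (hμ : M.IsSteadyState μ) :
    M.meanWaitH μ = ENNReal.ofReal M.lamH⁻¹ * ∑' s, μ s * (s.1 : ℝ≥0∞) := by
  have h1 := hM.lamH_pos
  have h2 := hM.totalRate_pos
  rw [hM.meanWaitH_eq_tsum, ← hM.lamH_div_mul_tsum_waiting hμ, ← mul_assoc,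
    ← ENNReal.ofReal_mul (by positivity)]
  congr 2
  field_simp

end Admissible

end Market

/-! ### Concentration of the scaled number of waiting `H` agents. -/

namespace Market

variable {M : Market}

theorem mul_one_sub_exp_neg_nonneg (z : ℝ) : 0 ≤ z * (1 - Real.exp (-z)) := by
  rcases le_total 0 z with h | h
  · exact mul_nonneg h (by simpa using h)
  · exact mul_nonneg_of_nonpos_of_nonpos h (by simpa using h)

/-- Converts the bound supplied by the drift into one on the mean of |z|. It rests on z²/(1 + |z|) ≤
z(1 - exp(-z)), used when |z| > δ. -/
theorem abs_le_add_mul_one_sub_exp_neg {δ : ℝ} (hδ : 0 < δ) (z : ℝ) :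
    |z| ≤ δ + (1 + δ⁻¹) * (z * (1 - Real.exp (-z))) := by
  have h0 := mul_one_sub_exp_neg_nonneg z
  rcases le_or_gt |z| δ with h | h
  · have : 0 ≤ (1 + δ⁻¹) * (z * (1 - Real.exp (-z))) := by positivity
    linarith
  have h1 : z ^ 2 / (1 + |z|) ≤ z * (1 - Real.exp (-z)) := by
    rcases le_total 0 z with hz | hz
    · rw [abs_of_nonneg hz, sq, mul_div_assoc]
      gcongr
      rw [Real.exp_neg, div_le_iff₀ (by linarith), ← sub_nonneg]
      have h3 : (Real.exp z)⁻¹ * (1 + z) ≤ 1 := by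
        rw [inv_mul_le_iff₀ (Real.exp_pos z)]
        linarith [Real.add_one_le_exp z]
      linarith
    · rw [abs_of_nonpos hz, div_le_iff₀ (by linarith)]
      have h3 := Real.add_one_le_exp (-z)
      have h4 : z ^ 2 ≤ z * (1 - Real.exp (-z)) := by nlinarith
      nlinarith
  have h2 : |z| ≤ (1 + δ⁻¹) * (z ^ 2 / (1 + |z|)) := by
    rw [← mul_div_assoc, le_div_iff₀ (by positivity), ← sq_abs]
    have : 1 ≤ δ⁻¹ * |z| := by
      rw [← div_eq_inv_mul, one_le_div hδ]
      exact h.le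
    nlinarith [abs_nonneg z]
  have h3 : (1 + δ⁻¹) * (z ^ 2 / (1 + |z|)) ≤ (1 + δ⁻¹) * (z * (1 - Real.exp (-z))) := by gcongr
  linarith

/-- Decay rate in the number of waiting `H` agents of the probability that an arriving `H` agent
forms no 2-cycle with any of them. -/
noncomputable def decay (M : Market) : ℝ := -Real.log (1 - M.pH ^ 2)

/-- Limit of the scaled number of waiting `H` agents. -/
noncomputable def level (M : Market) : ℝ := Real.log (2 * (M.lamH / M.totalRate))

namespace Admissible

theorem decay_pos (hM : M.Admissible) : 0 < M.decay := by
  have h1 := hM.pH_pos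
  have h2 := hM.pH_lt
  exact neg_pos.2 (Real.log_neg (by nlinarith) (by nlinarith))

theorem pow_eq_exp (hM : M.Admissible) (n : ℕ) :
    (1 - M.p .H * M.pH) ^ n = Real.exp (-(M.decay * n)) := by
  have h1 : 0 < 1 - M.pH ^ 2 := by nlinarith [hM.pH_pos, hM.pH_lt]
  rw [decay, neg_mul, neg_neg, mul_comm (Real.log _), Real.exp_nat_mul, Real.exp_log h1, sq]
  rfl

/-- The quadratic term measures the distance of h from its equilibrium. The linear term in e is
tuned to `H`–`E` matches: when an arriving `H` agent takes an `E` agent instead of joining, the loss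
of `level` cancels the part of the quadratic change that could have the wrong sign. -/
theorem drift_level (hM : M.Admissible) (hlt : M.lamE < M.lamH) (s : MarketState) :
    M.next (fun s => M.decay / 2 * ((s.1 : ℝ) - M.level / M.decay) ^ 2 + M.level * s.2) s +
      (M.decay * s.1 - M.level) * (1 - Real.exp (-(M.decay * s.1 - M.level))) ≤
    M.decay / 2 * ((s.1 : ℝ) - M.level / M.decay) ^ 2 + M.level * s.2 +
      (M.decay / 2 + M.decay / (M.pE * M.pH)) := by
  have hΛ := hM.totalRate_pos
  have hθ := hM.decay_pos
  set α := M.lamH / M.totalRate with hα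
  set β := M.lamE / M.totalRate with hβ
  have hα0 : 0 < α := div_pos hM.lamH_pos hΛ
  have hβ0 : 0 < β := div_pos hM.lamE_pos hΛ
  have hαβ : α + β = 1 := by
    rw [hα, hβ, ← add_div]
    exact div_self hΛ.ne'
  have hβα : β < α := div_lt_div_of_pos_right hlt hΛ
  have hx0 : 0 ≤ M.level := Real.log_nonneg (by linarith)
  have hexp : Real.exp M.level = 2 * α := Real.exp_log (by linarith)
  rw [next, M.afterArrival_formula
      (fun x y => M.decay / 2 * (x - M.level / M.decay) ^ 2 + M.level * y) .H,
    M.afterArrival_formula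
      (fun x y => M.decay / 2 * (x - M.level / M.decay) ^ 2 + M.level * y) .E, ← hα, ← hβ]
  -- This is 2α exp(-θh), so the main drift (θh - x₀)(2α exp(-θh) - 1) is -z(1 - exp(-z)).
  have hexp2 : Real.exp (-(M.decay * s.1 - M.level)) = 2 * α * (1 - M.p .H * M.pH) ^ s.1 := by
    rw [hM.pow_eq_exp, ← hexp, ← Real.exp_add]
    congr 1
    ring
  rw [hexp2]
  set θ := M.decay
  set x₀ := M.level
  set V := θ / 2 * ((s.1 : ℝ) - x₀ / θ) ^ 2 + x₀ * s.2 with hV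
  have hy : (0 : ℝ) ≤ s.1 := Nat.cast_nonneg _
  -- arrivals of `H` agents
  have hHle : M.join .H s * (θ / 2 * (((s.add .H).1 : ℝ) - x₀ / θ) ^ 2 + x₀ * (s.add .H).2) +
      M.matchE .H s * (θ / 2 * ((s.1 : ℝ) - x₀ / θ) ^ 2 + x₀ * ((s.2 : ℝ) - 1)) +
      M.matchH .H s * (θ / 2 * ((s.1 : ℝ) - 1 - x₀ / θ) ^ 2 + x₀ * s.2) ≤
      V + (θ * s.1 - x₀) * (2 * (1 - M.p .H * M.pH) ^ s.1 - 1) + θ / 2 := by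
    have h1 := hM.powH_pos .H s.1
    have h3 := hM.powE_nonneg .H s.2
    have h4 := hM.powE_le .H s.2
    simp only [join, matchE, matchH, MarketState.add, hV]
    push_cast
    set a := (1 - M.p .H * M.pH) ^ s.1
    set u := (1 - M.p .H * M.pE) ^ s.2
    have key : 0 ≤ a * (1 - u) * (θ * s.1 + θ / 2) :=
      mul_nonneg (mul_nonneg h1.le (by linarith)) (by positivity)
    refine le_of_sub_nonneg (key.trans_eq ?_)
    field_simp
    ring
  -- arrivals of `E` agents
  have hEle : M.join .E s * (θ / 2 * (((s.add .E).1 : ℝ) - x₀ / θ) ^ 2 + x₀ * (s.add .E).2) +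
      M.matchE .E s * (θ / 2 * ((s.1 : ℝ) - x₀ / θ) ^ 2 + x₀ * ((s.2 : ℝ) - 1)) +
      M.matchH .E s * (θ / 2 * ((s.1 : ℝ) - 1 - x₀ / θ) ^ 2 + x₀ * s.2) ≤
      V - (θ * s.1 - x₀) + θ / (M.pE * M.pH) + θ / 2 := by
    have h1 := hM.powH_pos .E s.1
    have h3 := hM.powE_nonneg .E s.2
    have h4 := hM.powE_le .E s.2
    -- The cost of `E` arrivals that find no compatible `H` agent: their probability decays at rate
    -- about pE pH in h, much faster than θ ~ pH².
    have h5 : θ * ((1 - M.p .E * M.pH) ^ s.1 * s.1) ≤ θ / (M.pE * M.pH) := by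
      rw [div_eq_mul_inv]
      exact mul_le_mul_of_nonneg_left (pow_mul_le (hM.mul_pH_pos .E) (hM.mul_pH_lt .E).le s.1) hθ.le
    simp only [join, matchE, matchH, MarketState.add, hV]
    push_cast
    set c := (1 - M.p .E * M.pH) ^ s.1
    set v := (1 - M.p .E * M.pE) ^ s.2
    have key : 0 ≤ c * (2 * (x₀ * (1 - v)) + θ / 2) := by
      have : 0 ≤ x₀ * (1 - v) := mul_nonneg hx0 (by linarith)
      positivity
    have h6 : 0 ≤ c * (2 * (x₀ * (1 - v)) + θ / 2) + (θ / (M.pE * M.pH) - θ * (c * s.1)) := by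
      linarith
    refine le_of_sub_nonneg (h6.trans_eq ?_)
    generalize θ / (M.pE * M.pH) = k
    field_simp
    ring
  have h1 := mul_le_mul_of_nonneg_left hHle hα0.le
  have h2 := mul_le_mul_of_nonneg_left hEle hβ0.le
  -- The error from `E` arrivals carries the weight β = 1 - α; this term allows rounding that weight
  -- up to 1.
  have h7 : 0 ≤ α * (θ / (M.pE * M.pH)) := by
    have := hM.pE_pos
    have := hM.pH_pos
    positivity
  have h3 : β = 1 - α := by linarith
  rw [h3] at h2 ⊢
  linarith

variable {μ : PMF MarketState}

theorem abs_decay_mul_mean_sub_level_le (hM : M.Admissible) (hlt : M.lamE < M.lamH)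
    (hμ : M.IsSteadyState μ) {δ : ℝ} (hδ : 0 < δ) :
    |M.decay * (∑' s, μ s * (s.1 : ℝ≥0∞)).toReal - M.level| ≤
      δ + (1 + δ⁻¹) * (M.decay / 2 + M.decay / (M.pE * M.pH)) := by
  have hΛ := hM.totalRate_pos
  have hθ := hM.decay_pos
  have hE := hM.pE_pos
  have hH := hM.pH_pos
  have hx0 : 0 ≤ M.level := by
    refine Real.log_nonneg ?_
    rw [← mul_div_assoc, one_le_div hΛ]
    unfold totalRate
    linarith
  set b := M.decay / 2 + M.decay / (M.pE * M.pH) with hb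
  have hb0 : 0 ≤ b := by positivity
  set z : MarketState → ℝ := fun s => M.decay * s.1 - M.level with hz
  set g : MarketState → ℝ := fun s => z s * (1 - Real.exp (-z s)) with hg
  have hg0 : ∀ s, 0 ≤ g s := fun s => mul_one_sub_exp_neg_nonneg _
  have hgb : ∑' s, μ s * ENNReal.ofReal (g s) ≤ ENNReal.ofReal b :=
    hM.tsum_mul_le_of_drift hμ
      (V := fun s => M.decay / 2 * ((s.1 : ℝ) - M.level / M.decay) ^ 2 + M.level * s.2)
      (fun s => by positivity) hg0 hb0 (hM.drift_level hlt)
  have hκ : 0 ≤ 1 + δ⁻¹ := by positivity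
  set m := ∑' s, μ s * (s.1 : ℝ≥0∞) with hm
  have hmt : m ≠ ∞ := hM.tsum_waitingH_ne_top hμ
  have hθm : ENNReal.ofReal (M.decay * m.toReal) = ENNReal.ofReal M.decay * m := by
    rw [ENNReal.ofReal_mul hθ.le, ENNReal.ofReal_toReal hmt]
  have hconst : ∀ c : ℝ≥0∞, ∑' s, μ s * c = c := fun c => by
    rw [ENNReal.tsum_mul_right, μ.tsum_coe, one_mul]
  have habs := fun s => abs_le_add_mul_one_sub_exp_neg hδ (z s)
  have hmean : ∑' s, μ s * ENNReal.ofReal (M.decay * s.1) = ENNReal.ofReal (M.decay * m.toReal) := by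
    rw [hθm, hm, ← ENNReal.tsum_mul_left]
    refine tsum_congr fun s => ?_
    rw [ENNReal.ofReal_mul hθ.le, ENNReal.ofReal_natCast]
    ring
  have hbound : ∀ x y : MarketState → ℝ, (∀ s, 0 ≤ y s) →
      (∀ s, x s ≤ y s + (δ + (1 + δ⁻¹) * g s)) →
      ∑' s, μ s * ENNReal.ofReal (x s) ≤
        ∑' s, μ s * ENNReal.ofReal (y s) + ENNReal.ofReal (δ + (1 + δ⁻¹) * b) := by
    intro x y hy hxy
    calc _ ≤ ∑' s, (μ s * ENNReal.ofReal (y s) + (μ s * ENNReal.ofReal δ +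
          ENNReal.ofReal (1 + δ⁻¹) * (μ s * ENNReal.ofReal (g s)))) := by
          refine ENNReal.tsum_le_tsum fun s => ?_
          calc _ ≤ μ s * ENNReal.ofReal (y s + (δ + (1 + δ⁻¹) * g s)) := by
                gcongr
                exact hxy s
            _ = _ := by
                rw [ENNReal.ofReal_add (hy s) (add_nonneg hδ.le (mul_nonneg hκ (hg0 s))),
                  ENNReal.ofReal_add hδ.le (mul_nonneg hκ (hg0 s)), ENNReal.ofReal_mul hκ]
                ring
      _ ≤ ∑' s, μ s * ENNReal.ofReal (y s) +
          (ENNReal.ofReal δ + ENNReal.ofReal (1 + δ⁻¹) * ENNReal.ofReal b) := by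
          rw [ENNReal.tsum_add, ENNReal.tsum_add, hconst, ENNReal.tsum_mul_left]
          gcongr
      _ = _ := by
          rw [← ENNReal.ofReal_mul hκ, ← ENNReal.ofReal_add hδ.le (mul_nonneg hκ hb0)]
  have hr : 0 ≤ δ + (1 + δ⁻¹) * b := add_nonneg hδ.le (mul_nonneg hκ hb0)
  have hθm0 : 0 ≤ M.decay * m.toReal := mul_nonneg hθ.le ENNReal.toReal_nonneg
  have hup := hbound (fun s => M.decay * s.1) (fun _ => M.level) (fun _ => hx0) fun s => by
    have := (le_abs_self (z s)).trans (habs s)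
    simp only [hz] at this
    linarith
  have hlo := hbound (fun _ => M.level) (fun s => M.decay * s.1) (fun s => by positivity) fun s => by
    have := (neg_le_abs (z s)).trans (habs s)
    simp only [hz] at this
    linarith
  rw [hmean, hconst, ← ENNReal.ofReal_add hx0 hr,
    ENNReal.ofReal_le_ofReal_iff (add_nonneg hx0 hr)] at hup
  rw [hmean, hconst, ← ENNReal.ofReal_add hθm0 hr,
    ENNReal.ofReal_le_ofReal_iff (add_nonneg hθm0 hr)] at hlo
  rw [abs_le]
  constructor <;> linarith

end Admissible

end Market

/-! ### Calculus: the root x* and the monotonicity of the limit. -/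

namespace WaitingTimeLimit

/-- The function `(y + 1) ln (2 - 2 / (y + 1))`. -/
noncomputable def crit (y : ℝ) : ℝ := (y + 1) * Real.log (2 - 2 / (y + 1))

theorem hasDerivAt_crit {y : ℝ} (hy : 0 < y) :
    HasDerivAt crit (Real.log (2 - 2 / (y + 1)) + 1 / y) y := by
  have h1 : HasDerivAt (fun y : ℝ => y + 1) 1 y := (hasDerivAt_id y).add_const 1
  have hy1 : y + 1 ≠ 0 := by positivity
  have hne : 2 - 2 / (y + 1) ≠ 0 := by
    have : 2 - 2 / (y + 1) = 2 * y / (y + 1) := by field_simp; ring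
    rw [this]
    positivity
  have h2 : HasDerivAt (fun y : ℝ => 2 - 2 / (y + 1)) (2 / (y + 1) ^ 2) y := by
    have := ((hasDerivAt_const y (2 : ℝ)).div h1 hy1).const_sub 2
    refine this.congr_deriv ?_
    field_simp
    ring
  refine (h1.mul (h2.log hne)).congr_deriv ?_
  have : 2 - 2 / (y + 1) = 2 * y / (y + 1) := by field_simp; ring
  rw [one_mul, this]
  field_simp

theorem log_nonneg_of_one_le {y : ℝ} (hy : 1 ≤ y) : 0 ≤ Real.log (2 - 2 / (y + 1)) := by
  refine Real.log_nonneg ?_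
  have : 2 / (y + 1) ≤ 1 := by rw [div_le_one (by linarith)]; linarith
  linarith

theorem strictMonoOn_crit : StrictMonoOn crit (Ici 1) := by
  refine strictMonoOn_of_deriv_pos (convex_Ici 1) ?_ ?_
  · exact fun y hy => (hasDerivAt_crit (lt_of_lt_of_le one_pos hy)).continuousAt.continuousWithinAt
  · intro y hy
    rw [interior_Ici, mem_Ioi] at hy
    rw [(hasDerivAt_crit (by linarith)).deriv]
    have := log_nonneg_of_one_le hy.le
    positivity

/-- Uniqueness of the root is claimed over all reals, so the conventions ln t = ln |t| and 2/0 = 0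
matter here. For -1 < y < 0 the bound ln t ≤ t/e gives at most -2y/e < 2/e < 1. -/
theorem crit_lt_one_of_lt {y : ℝ} (hy : y < 1) : crit y < 1 := by
  unfold crit
  rcases lt_trichotomy (y + 1) 0 with h | h | h
  · have h2 : 0 ≤ Real.log (2 - 2 / (y + 1)) := by
      refine Real.log_nonneg ?_
      have := div_neg_of_pos_of_neg (two_pos (α := ℝ)) h
      linarith
    nlinarith
  · simp [h]
  · rcases le_or_gt 0 y with hy0 | hy0
    · have h1 : 2 - 2 / (y + 1) = 2 * y / (y + 1) := by field_simp; ring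
      have h2 : Real.log (2 - 2 / (y + 1)) ≤ 0 := by
        refine Real.log_nonpos ?_ ?_
        · rw [h1]; positivity
        · rw [h1, div_le_one h]; linarith
      nlinarith
    · have h1 : -(2 - 2 / (y + 1)) = 2 * (-y) / (y + 1) := by field_simp; ring
      have h3 : 0 < -(2 - 2 / (y + 1)) := by
        rw [h1]
        exact div_pos (by linarith) h
      have h2 : Real.log (2 - 2 / (y + 1)) ≤ -(2 - 2 / (y + 1)) / Real.exp 1 := by
        rw [← Real.log_neg_eq_log]
        have := Real.log_le_sub_one_of_pos (div_pos h3 (Real.exp_pos 1))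
        rw [Real.log_div h3.ne' (Real.exp_pos 1).ne', Real.log_exp] at this
        linarith
      have he := Real.exp_one_gt_d9
      calc _ ≤ (y + 1) * (-(2 - 2 / (y + 1)) / Real.exp 1) := by gcongr
        _ = 2 * (-y) / Real.exp 1 := by rw [h1]; field_simp
        _ < 1 := by
          rw [div_lt_one (Real.exp_pos 1)]
          linarith

theorem crit_lt_one : crit 2.175 < 1 := by
  -- At y = 2.175, 2 - 2/(y + 1) = 174/127 and 1/(y + 1) = 40/127; a Taylor sum bounds the
  -- exponential from below.
  have h : Real.log (174 / 127) < 40 / 127 := by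
    rw [Real.log_lt_iff_lt_exp (by norm_num)]
    refine lt_of_lt_of_le ?_ (Real.sum_le_exp_of_nonneg (by norm_num) 6)
    norm_num [Finset.sum_range_succ, Nat.factorial]
  unfold crit
  norm_num at h ⊢
  linarith

theorem one_lt_crit : 1 < crit 2.185 := by
  have h : 200 / 637 < Real.log (874 / 637) := by
    rw [Real.lt_log_iff_exp_lt (by norm_num)]
    refine lt_of_le_of_lt (Real.exp_bound' (n := 5) (by norm_num) (by norm_num) (by norm_num)) ?_
    norm_num [Finset.sum_range_succ, Nat.factorial]
  unfold crit
  norm_num at h ⊢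
  linarith

theorem exists_root : ∃ x : ℝ, 1 < x ∧ |x - 2.18| < 0.005 ∧ crit x = 1 ∧
    ∀ y : ℝ, crit y = 1 ↔ y = x := by
  obtain ⟨x, hx, hx1⟩ := intermediate_value_Ioo (show (2.175 : ℝ) ≤ 2.185 by norm_num)
    (fun y hy => (hasDerivAt_crit (lt_of_lt_of_le (by norm_num) hy.1)).continuousAt.continuousWithinAt)
    (show (1 : ℝ) ∈ Ioo (crit 2.175) (crit 2.185) from ⟨crit_lt_one, one_lt_crit⟩)
  have h1 : 1 < x := lt_trans (by norm_num) hx.1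
  refine ⟨x, h1, ?_, hx1, fun y => ⟨fun hy => ?_, fun h => h ▸ hx1⟩⟩
  · rw [abs_lt]
    constructor <;> norm_num at hx ⊢ <;> linarith [hx.1, hx.2]
  · rcases lt_or_ge y 1 with h | h
    · exact absurd hy (crit_lt_one_of_lt h).ne
    · exact strictMonoOn_crit.injOn h h1.le (hy.trans hx1.symm)

/-- The limit of the scaled waiting time as a function of the arrival rate `l` of `H` agents, the
arrival rate of `E` agents being `c`. -/
noncomputable def limitWait (c l : ℝ) : ℝ := Real.log (2 * (l / (l + c))) / l

/-- Written so that the first factor is positive and the sign is that of 1 - `crit (l / c)`. -/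
theorem hasDerivAt_limitWait {c l : ℝ} (hc : 0 < c) (hl : 0 < l) :
    HasDerivAt (limitWait c) (c / ((l + c) * l ^ 2) * (1 - crit (l / c))) l := by
  have h1 : HasDerivAt (fun l : ℝ => 2 * (l / (l + c))) (2 * (c / (l + c) ^ 2)) l := by
    have h := ((hasDerivAt_id l).div ((hasDerivAt_id l).add_const c)
      (show l + c ≠ 0 by positivity)).const_mul 2
    refine h.congr_deriv ?_
    simp only [id]
    ring
  have h2 := (h1.log (by positivity)).div (hasDerivAt_id l) hl.ne'
  refine h2.congr_deriv ?_
  have h3 : 2 - 2 / (l / c + 1) = 2 * (l / (l + c)) := by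
    field_simp
    ring
  simp only [crit, h3, id]
  field_simp

theorem limitWait_pos {c l : ℝ} (hc : 0 < c) (hl : c < l) : 0 < limitWait c l := by
  refine div_pos (Real.log_pos ?_) (hc.trans hl)
  rw [← mul_div_assoc, lt_div_iff₀ (by linarith)]
  linarith

theorem strictMonoOn_limitWait {c x : ℝ} (hc : 0 < c) (hx1 : 1 < x) (hx : crit x = 1) :
    StrictMonoOn (limitWait c) (Ioo c (x * c)) := by
  refine strictMonoOn_of_deriv_pos (convex_Ioo _ _) ?_ ?_
  · exact fun l hl =>
      (hasDerivAt_limitWait hc (hc.trans hl.1)).continuousAt.continuousWithinAt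
  · intro l hl
    rw [interior_Ioo] at hl
    have hl0 := hc.trans hl.1
    rw [(hasDerivAt_limitWait hc hl0).deriv]
    have h1 : crit (l / c) < crit x := strictMonoOn_crit ((one_lt_div hc).2 hl.1).le hx1.le
      ((div_lt_iff₀ hc).2 hl.2)
    exact mul_pos (by positivity) (by linarith)

theorem strictAntiOn_limitWait {c x : ℝ} (hc : 0 < c) (hx1 : 1 < x) (hx : crit x = 1) :
    StrictAntiOn (limitWait c) (Ioi (x * c)) := by
  have hlt : ∀ l ∈ Ioi (x * c), 0 < l := fun l hl => lt_trans (by positivity) (mem_Ioi.1 hl)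
  refine strictAntiOn_of_deriv_neg (convex_Ioi _) ?_ ?_
  · exact fun l hl => (hasDerivAt_limitWait hc (hlt l hl)).continuousAt.continuousWithinAt
  · intro l hl
    rw [interior_Ioi] at hl
    have hl0 := hlt l hl
    rw [(hasDerivAt_limitWait hc hl0).deriv]
    have h2 := (lt_div_iff₀ hc).2 hl
    have h1 : crit x < crit (l / c) := strictMonoOn_crit hx1.le (hx1.trans h2).le h2
    exact mul_neg_of_pos_of_neg (by positivity) (by linarith)

end WaitingTimeLimit

/-! ### The limit pH → 0 and the conclusion. -/

namespace Market

theorem le_neg_log_one_sub {q : ℝ} (hq1 : q < 1) : q ≤ -Real.log (1 - q) := by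
  linarith [Real.log_le_sub_one_of_pos (sub_pos.2 hq1)]

theorem neg_log_one_sub_le {q : ℝ} (hq1 : q < 1) : -Real.log (1 - q) ≤ q / (1 - q) := by
  have h := sub_pos.2 hq1
  have h1 := Real.one_sub_inv_le_log_of_pos h
  have h2 : q / (1 - q) = (1 - q)⁻¹ - 1 := by field_simp; ring
  linarith

/-- The scaled mean waiting time of `H` agents in steady state converges as `pH → 0`. -/
theorem tendsto_meanWaitH {lamH lamE pE : ℝ} (hE : 0 < lamE) (hlt : lamE < lamH) (hpE : 0 < pE)
    (hpE1 : pE ≤ 1) {π : ℝ → PMF MarketState}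
    (hπ : ∀ pH, 0 < pH → pH < 1 → IsSteadyState ⟨lamH, lamE, pH, pE⟩ (π pH)) :
    Tendsto (fun pH : ℝ => ENNReal.ofReal (pH ^ 2) * meanWaitH ⟨lamH, lamE, pH, pE⟩ (π pH))
      (𝓝[>] 0) (𝓝 (ENNReal.ofReal (WaitingTimeLimit.limitWait lamE lamH))) := by
  have hH : 0 < lamH := hE.trans hlt
  have hadm : ∀ pH : ℝ, 0 < pH → pH < 1 → (⟨lamH, lamE, pH, pE⟩ : Market).Admissible :=
    fun pH h h1 => ⟨hH, hE, h, h1, hpE, hpE1⟩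
  set x₀ := Real.log (2 * (lamH / (lamH + lamE))) with hx₀
  set θ : ℝ → ℝ := fun p => -Real.log (1 - p ^ 2) with hθ
  set m : ℝ → ℝ := fun p => (∑' s, π p s * (s.1 : ℝ≥0∞)).toReal with hm
  have hev : ∀ᶠ p : ℝ in 𝓝[>] 0, 0 < p ∧ p < 1 := Ioo_mem_nhdsGT one_pos
  have hid : Tendsto (fun p : ℝ => p) (𝓝[>] 0) (𝓝 0) := tendsto_nhdsWithin_of_tendsto_nhds tendsto_id
  have hθ0 : Tendsto (fun p => θ p / p ^ 2) (𝓝[>] 0) (𝓝 1) := by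
    have h1 : Tendsto (fun p : ℝ => (1 - p ^ 2)⁻¹) (𝓝[>] 0) (𝓝 1) := by
      have := ((hid.pow 2).const_sub 1).inv₀ (by norm_num)
      simpa using this
    -- Squeeze by q ≤ -ln(1 - q) ≤ q/(1 - q) at q = p².
    refine tendsto_of_tendsto_of_tendsto_of_le_of_le' tendsto_const_nhds h1 ?_ ?_
    · filter_upwards [hev] with p hp
      rw [one_le_div (pow_pos hp.1 2)]
      exact le_neg_log_one_sub (by nlinarith)
    · filter_upwards [hev] with p hp
      rw [div_le_iff₀ (pow_pos hp.1 2), ← div_eq_inv_mul]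
      exact neg_log_one_sub_le (by nlinarith)
  have hb : Tendsto (fun p => θ p / 2 + θ p / (pE * p)) (𝓝[>] 0) (𝓝 0) := by
    have h1 : Tendsto (fun p => θ p / p ^ 2 * (p ^ 2 / 2 + p / pE)) (𝓝[>] 0)
        (𝓝 (1 * (0 ^ 2 / 2 + 0 / pE))) :=
      hθ0.mul (((hid.pow 2).div_const 2).add (hid.div_const pE))
    have h2 : (1 : ℝ) * (0 ^ 2 / 2 + 0 / pE) = 0 := by norm_num
    rw [h2] at h1
    refine h1.congr' ?_
    filter_upwards [hev] with p hp
    have := hp.1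
    field_simp
  have hmean : Tendsto (fun p => θ p * m p) (𝓝[>] 0) (𝓝 x₀) := by
    rw [Metric.tendsto_nhds]
    intro ε hε
    have hκ : Tendsto (fun p => ε / 2 + (1 + (ε / 2)⁻¹) * (θ p / 2 + θ p / (pE * p))) (𝓝[>] 0)
        (𝓝 (ε / 2 + (1 + (ε / 2)⁻¹) * 0)) := (hb.const_mul _).const_add _
    rw [mul_zero, add_zero] at hκ
    filter_upwards [hev, hκ.eventually_lt_const (half_lt_self hε)] with p hp hp2
    rw [Real.dist_eq]
    exact ((hadm p hp.1 hp.2).abs_decay_mul_mean_sub_level_le hlt (hπ p hp.1 hp.2)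
      (half_pos hε)).trans_lt hp2
  have hlim : Tendsto (fun p => (θ p / p ^ 2)⁻¹ * (θ p * m p) / lamH) (𝓝[>] 0)
      (𝓝 (1⁻¹ * x₀ / lamH)) := ((hθ0.inv₀ one_ne_zero).mul hmean).div_const _
  rw [inv_one, one_mul] at hlim
  refine (ENNReal.tendsto_ofReal hlim).congr' ?_
  filter_upwards [hev] with p hp
  have hM := hadm p hp.1 hp.2
  have hθp : 0 < θ p := hM.decay_pos
  rw [hM.meanWaitH_eq (hπ p hp.1 hp.2),
    ← ENNReal.ofReal_toReal (hM.tsum_waitingH_ne_top (hπ p hp.1 hp.2)),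
    ← ENNReal.ofReal_mul (inv_nonneg.2 hH.le), ← ENNReal.ofReal_mul (sq_nonneg p)]
  congr 1
  change _ = p ^ 2 * (lamH⁻¹ * m p)
  have := hp.1
  field_simp

end Market

theorem mainTheorem5 :
    ∃ x : ℝ,
      (∀ y : ℝ, (y + 1) * Real.log (2 - 2 / (y + 1)) = 1 ↔ y = x) ∧
      |x - 2.18| < 0.005 ∧
      ∀ lamE : ℝ, 0 < lamE → ∀ pE : ℝ, 0 < pE → pE ≤ 1 →
        ∃ (π : ℝ → ℝ → PMF MarketState) (W : ℝ → ℝ≥0),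
          -- `π lamH pH` is the unique steady-state distribution
          (∀ lamH : ℝ, lamE < lamH → ∀ pH : ℝ, 0 < pH → pH < 1 →
            ∀ μ : PMF MarketState,
              Market.IsSteadyState ⟨lamH, lamE, pH, pE⟩ μ ↔ μ = π lamH pH) ∧
          -- `W lamH` is the limiting average waiting time of `H` agents (scaled by `pH ^ 2`)
          (∀ lamH : ℝ, lamE < lamH →
            Tendsto
              (fun pH : ℝ => ENNReal.ofReal (pH ^ 2) *
                Market.meanWaitH ⟨lamH, lamE, pH, pE⟩ (π lamH pH))
              (𝓝[>] 0) (𝓝 (W lamH : ℝ≥0∞))) ∧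
          StrictMonoOn W (Ioo lamE (x * lamE)) ∧
          StrictAntiOn W (Ioi (x * lamE)) := by
  obtain ⟨x, hx1, hx, hroot, huniq⟩ := WaitingTimeLimit.exists_root
  refine ⟨x, huniq, hx, fun lamE hE pE hpE hpE1 => ?_⟩
  have hex : ∀ lamH pH : ℝ, ∃ π : PMF MarketState, lamE < lamH → 0 < pH → pH < 1 →
      ∀ μ : PMF MarketState, Market.IsSteadyState ⟨lamH, lamE, pH, pE⟩ μ ↔ μ = π := by
    intro lamH pH
    by_cases h : lamE < lamH ∧ 0 < pH ∧ pH < 1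
    · have hM : (⟨lamH, lamE, pH, pE⟩ : Market).Admissible :=
        ⟨hE.trans h.1, hE, h.2.1, h.2.2, hpE, hpE1⟩
      obtain ⟨π, hπ⟩ := hM.exists_steadyState
      exact ⟨π, fun _ _ _ μ => ⟨fun hμ => hM.steadyState_unique hμ hπ, fun hμ => hμ ▸ hπ⟩⟩
    -- An arbitrary value outside the admissible range, needed only to make the choice of π total.
    · exact ⟨PMF.pure (0, 0), fun h1 h2 h3 => absurd ⟨h1, h2, h3⟩ h⟩
  choose π hπ using hex
  have hpos : ∀ l ∈ Ioi (x * lamE), lamE < l := fun l hl =>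
    lt_trans (by nlinarith) (mem_Ioi.1 hl)
  refine ⟨π, fun l => (WaitingTimeLimit.limitWait lamE l).toNNReal,
    fun lamH hlt pH h0 h1 => hπ lamH pH hlt h0 h1, fun lamH hlt => ?_, ?_, ?_⟩
  · exact Market.tendsto_meanWaitH hE hlt hpE hpE1
      fun pH h0 h1 => (hπ lamH pH hlt h0 h1 _).2 rfl
  -- Truncation to nonnegative reals preserves strict inequalities because the limit is positive for
  -- lamH > lamE.
  · exact fun a ha b hb hab => (Real.toNNReal_lt_toNNReal_iff
      (WaitingTimeLimit.limitWait_pos hE hb.1)).2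
      (WaitingTimeLimit.strictMonoOn_limitWait hE hx1 hroot ha hb hab)
  · exact fun a ha b hb hab => (Real.toNNReal_lt_toNNReal_iff
      (WaitingTimeLimit.limitWait_pos hE (hpos a ha))).2
      (WaitingTimeLimit.strictAntiOn_limitWait hE hx1 hroot ha hb hab)
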